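/- Let $K$ be a field of characteristic $0$ that is complete with respect to a nontrivial non-archimedean absolute value $|\cdot|$. A power series in $K[[x,y]]$ is called analytic if it converges at every point of some polydisc around $0$. Let $F,G\in (K[[x,y]])^2$ be pairs of analytic power series of the form $$(\lambda_1x+O(2),\ \lambda_2y+O(2)),$$ with the same nonzero $\lambda_1,\lambda_2\in K$, where $O(2)$ denotes a power series all of whose terms have total degree at least $2$. Assume that one of the following holds: 1. (Attracting/repelling case) $\lambda_2=\lambda_1^n$ for some integer $n\ge 2$, and $|\lambda_1|\ne 1$, $|\lambda_2|\neq 1$; 2. (Semihyperbolic case) $\lambda_1=1$ and $|\lambda_2|\ne 1$. Then $F$ and $G$ are formally equivalent if and only if they are analytically equivalent. Here $F$ and $G$ are formally equivalent if $H\circ F\circ H^{-1}=G$ for some pair $H\in (K[[x,y]])^2$ of power series without constant term that has an inverse $H^{-1}$ of the same kind under composition; they are analytically equivalent if $H$ can be chosen such that $H$ and $H^{-1}$ are both analytic. -/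

import Mathlib

/-- A formal map of `K^r` fixing the origin: an `r`-tuple of formal power series in `r` variables,
each with zero constant term. -/
@[ext]
structure FormalMap (K : Type*) [Field K] (r : ℕ) where
  /-- The components of the map. -/
  comp : Fin r → MvPowerSeries (Fin r) K
  /-- The map fixes the origin. -/
  map_zero : ∀ k, MvPowerSeries.constantCoeff (comp k) = 0

namespace FormalMap

variable {K : Type*} [Field K] {r : ℕ}

/-- The identity map `(x₁, …, x_r)`. -/
noncomputable def idMap : FormalMap K r where
  comp k := MvPowerSeries.X k
  map_zero k := by simp

/-- The composite `F ∘ G`: the series of `G` are substituted for the variables in each series of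
`F`. -/
noncomputable def circ (F G : FormalMap K r) : FormalMap K r where
  comp k := MvPowerSeries.subst G.comp (F.comp k)
  map_zero k := MvPowerSeries.constantCoeff_subst_eq_zero
    (MvPowerSeries.hasSubst_of_constantCoeff_zero G.map_zero) G.map_zero (F.map_zero k)

/-- `F` and `G` are two-sided inverses of each other under composition. -/
def AreInverse (F G : FormalMap K r) : Prop :=
  F.circ G = idMap ∧ G.circ F = idMap

/-- `F` has the form `(l₁ x₁ + O(2), …, l_r x_r + O(2))`: its linear part is diagonal with
entries `l₁, …, l_r`. -/
def HasDiagonalLinearPart (F : FormalMap K r) (l : Fin r → K) : Prop :=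
  ∀ i j, MvPowerSeries.coeff (Finsupp.single j 1) (F.comp i) = if i = j then l i else 0

/-- `F` and `G` are conjugate in the group of invertible formal maps. -/
def FormallyEquivalent (F G : FormalMap K r) : Prop :=
  ∃ H H' : FormalMap K r, AreInverse H H' ∧ (H.circ F).circ H' = G

end FormalMap

/-- A power series is analytic at `0` if it converges at every point of some (open) polydisc
around `0`. -/
def IsAnalyticSeries {K : Type*} [NormedField K] {r : ℕ} (f : MvPowerSeries (Fin r) K) : Prop :=
  ∃ ε : Fin r → ℝ, (∀ i, 0 < ε i) ∧
    ∀ x : Fin r → K, (∀ i, ‖x i‖ < ε i) →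
      Summable fun a : Fin r →₀ ℕ => MvPowerSeries.coeff a f * ∏ i, x i ^ a i

namespace FormalMap

variable {K : Type*} [NormedField K] {r : ℕ}

/-- A map is analytic at `0` if all its components are. -/
def IsAnalytic (F : FormalMap K r) : Prop :=
  ∀ k, IsAnalyticSeries (F.comp k)

/-- `F` and `G` are conjugate in the group of invertible analytic maps. -/
def AnalyticallyEquivalent (F G : FormalMap K r) : Prop :=
  ∃ H H' : FormalMap K r, H.IsAnalytic ∧ H'.IsAnalytic ∧ AreInverse H H' ∧
    (H.circ F).circ H' = G

end FormalMap

/-! Analytic equivalence trivially implies formal equivalence. For the converse, a conjugation of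
`F` to `G` also conjugates the inverse maps, so every eigenvalue of norm different from one may be
assumed to have norm less than one. Over a complete non-archimedean field analyticity means
geometric growth of the coefficients (`isAnalyticSeries_iff`), so the task is to bound coefficient
recursions, in which a sum costs no more than its largest term.

Attracting case. A formal conjugation `H` satisfies (λ^a - λ_i) h_{i,a} = an expression in
coefficients of lower degree. Since λ^a tends to 0, the divisor has norm |λ_i| once |a| is large:
there are no small divisors, and resonances affect only finitely many coefficients. Hence every
formal conjugation is already analytic (`FormalMap.IsAnalytic.of_attracting`). The relation λ₂ =
λ₁^n matters only through λ₁ ≠ λ₂, which makes the linear part of `H` diagonal.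

Semihyperbolic case, eigenvalues 1 and c with |c| < 1. The divisors c^n - 1 and c^n - c are either
zero for a resonant monomial or of norm at least |c|, so the Poincaré–Dulac normalisation converges
(`FormalMap.exists_normalForm`) and the map becomes a skew product (f(x), lam(x) y) with f tangent
to the identity. A formal conjugation of skew products preserves the axis y = 0 because c ≠ 1; its
restriction h to the axis and its transverse factor u there satisfy h ∘ f = g ∘ h and (u ∘ f) lam =
(mu ∘ h) u (`FormalMap.exists_skew_conj`).

These one-variable equations are then solved analytically (`exists_analytic_skew_conj`). If f = x +
ψ x^(k+1) with ψ(0) ≠ 0, step n of the recursion divides by n ψ(0), which leads to bounds of the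
form A^n / |n!|. In a non-archimedean field of characteristic zero 1/n! grows only geometrically
(`exists_inv_norm_factorial_le`), so h and u converge. If f = x, then g = x and lam = mu ∘ h: either
mu is constant and h can be replaced by x, or h is forced to be analytic; u can be replaced by 1. -/

open MvPowerSeries in
/-- All coefficients of total degree less than `n` vanish. -/
def VanishBelow {σ K : Type*} [Field K] (n : ℕ) (f : MvPowerSeries σ K) : Prop :=
  ∀ a : σ →₀ ℕ, a.degree < n → coeff a f = 0

/-- The monomial `∏ H_s ^ b_s` in the entries of a family of power series. -/
noncomputable def seriesMonomial {σ τ K : Type*} [Field K] (H : σ → MvPowerSeries τ K)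
    (b : σ →₀ ℕ) : MvPowerSeries τ K :=
  b.prod fun s e => H s ^ e

/-! ### Order of vanishing of monomials in power series -/

section Vanish

open MvPowerSeries

variable {σ τ K : Type*} [Field K]

namespace VanishBelow

theorem zero (n : ℕ) : VanishBelow n (0 : MvPowerSeries σ K) := fun _ _ => by simp

theorem mono {m n : ℕ} (h : m ≤ n) {f : MvPowerSeries σ K} (hf : VanishBelow n f) :
    VanishBelow m f := fun a ha => hf a (ha.trans_le h)

theorem add {n : ℕ} {f g : MvPowerSeries σ K} (hf : VanishBelow n f) (hg : VanishBelow n g) :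
    VanishBelow n (f + g) := fun a ha => by rw [map_add, hf a ha, hg a ha, add_zero]

theorem mul {m n : ℕ} {f g : MvPowerSeries σ K} (hf : VanishBelow m f) (hg : VanishBelow n g) :
    VanishBelow (m + n) (f * g) := by
  classical
  intro a ha
  rw [coeff_mul]
  refine Finset.sum_eq_zero fun p hp => ?_
  have hp' := congrArg Finsupp.degree (Finset.HasAntidiagonal.mem_antidiagonal.mp hp)
  rw [map_add] at hp'
  rcases lt_or_ge p.1.degree m with h | h
  · rw [hf _ h, zero_mul]
  · rw [hg _ (by omega), mul_zero]

theorem pow {n : ℕ} {f : MvPowerSeries σ K} (hf : VanishBelow n f) (e : ℕ) :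
    VanishBelow (e * n) (f ^ e) := by
  induction e with
  | zero => intro a ha; omega
  | succ e ih => rw [pow_succ, Nat.succ_mul]; exact ih.mul hf

theorem of_constantCoeff {f : MvPowerSeries σ K} (hf : constantCoeff f = 0) :
    VanishBelow 1 f := by
  intro a ha
  have : a = 0 := (Finsupp.degree_eq_zero_iff a).mp (by omega)
  rw [this, coeff_zero_eq_constantCoeff_apply, hf]

end VanishBelow

variable (H H' : σ → MvPowerSeries τ K)

@[simp] theorem seriesMonomial_zero : seriesMonomial H 0 = 1 := Finsupp.prod_zero_index

theorem seriesMonomial_add (b c : σ →₀ ℕ) :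
    seriesMonomial H (b + c) = seriesMonomial H b * seriesMonomial H c := by
  classical
  exact Finsupp.prod_add_index' (fun _ => pow_zero _) (fun _ _ _ => pow_add _ _ _)

theorem seriesMonomial_single (s : σ) (e : ℕ) :
    seriesMonomial H (Finsupp.single s e) = H s ^ e :=
  Finsupp.prod_single_index (pow_zero _)

variable {H H'}

theorem vanishBelow_seriesMonomial (hH : ∀ s, constantCoeff (H s) = 0) (b : σ →₀ ℕ) :
    VanishBelow b.degree (seriesMonomial H b) := by
  induction b using Finsupp.induction_linear with
  | zero => intro a ha; simp at ha
  | add b c hb hc => rw [seriesMonomial_add, map_add]; exact hb.mul hc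
  | single s e =>
    rw [seriesMonomial_single, Finsupp.degree_single]
    simpa using (VanishBelow.of_constantCoeff (hH s)).pow e

theorem vanishBelow_pow_sub_pow {n : ℕ} {f g : MvPowerSeries σ K} (hf : constantCoeff f = 0)
    (hg : constantCoeff g = 0) (h : VanishBelow (n + 1) (f - g)) (e : ℕ) :
    VanishBelow (n + e) (f ^ e - g ^ e) := by
  induction e with
  | zero => simpa using VanishBelow.zero _
  | succ e ih =>
    have : f ^ (e + 1) - g ^ (e + 1) = (f ^ e - g ^ e) * f + g ^ e * (f - g) := by ring
    rw [this]
    refine (ih.mul (VanishBelow.of_constantCoeff hf)).add ?_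
    refine (((VanishBelow.of_constantCoeff hg).pow e).mul h).mono (by omega)

/-- Telescoping changes one factor at a time; the difference has order at least n + 1, and each of
the other |b| - 1 factors has order at least one. -/
theorem vanishBelow_seriesMonomial_sub {n : ℕ} (hH : ∀ s, constantCoeff (H s) = 0)
    (hH' : ∀ s, constantCoeff (H' s) = 0) (h : ∀ s, VanishBelow (n + 1) (H s - H' s))
    (b : σ →₀ ℕ) : VanishBelow (n + b.degree) (seriesMonomial H b - seriesMonomial H' b) := by
  induction b using Finsupp.induction_linear with
  | zero => simpa using VanishBelow.zero _
  | add b c hb hc =>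
    rw [seriesMonomial_add, seriesMonomial_add, map_add]
    have : seriesMonomial H b * seriesMonomial H c - seriesMonomial H' b * seriesMonomial H' c =
      (seriesMonomial H b - seriesMonomial H' b) * seriesMonomial H c +
        seriesMonomial H' b * (seriesMonomial H c - seriesMonomial H' c) := by ring
    rw [this]
    refine ((hb.mul (vanishBelow_seriesMonomial hH c)).mono (by omega)).add ?_
    exact ((vanishBelow_seriesMonomial hH' b).mul hc).mono (by omega)
  | single s e =>
    rw [seriesMonomial_single, seriesMonomial_single, Finsupp.degree_single]
    exact vanishBelow_pow_sub_pow (hH s) (hH' s) (h s) e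

/-- The coefficients of degree at most `n + 1` of a monomial of degree at least two depend only on
the coefficients of degree at most `n` of the substituted series. -/
theorem coeff_seriesMonomial_congr (hH : ∀ s, constantCoeff (H s) = 0)
    (hH' : ∀ s, constantCoeff (H' s) = 0) {N : ℕ}
    (h : ∀ s, ∀ a : τ →₀ ℕ, a.degree < N → coeff a (H s) = coeff a (H' s)) {b : σ →₀ ℕ}
    (hb : 2 ≤ b.degree) {a : τ →₀ ℕ} (ha : a.degree ≤ N) :
    coeff a (seriesMonomial H b) = coeff a (seriesMonomial H' b) := by
  rcases N with _ | n
  · rw [vanishBelow_seriesMonomial hH b a (by omega), vanishBelow_seriesMonomial hH' b a (by omega)]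
  · have := vanishBelow_seriesMonomial_sub (n := n) hH hH'
      (fun s a ha => by rw [map_sub, h s a ha, sub_self]) b a (by omega)
    rwa [map_sub, sub_eq_zero] at this

end Vanish

/-! ### Ultrametric coefficient bounds for products and substitutions -/

section Bounds

open MvPowerSeries

variable {σ τ K : Type*} [NormedField K]

theorem norm_coeff_one_le {A : ℝ} (hA : 0 ≤ A) (a : σ →₀ ℕ) :
    ‖coeff a (1 : MvPowerSeries σ K)‖ ≤ 1 * A ^ a.degree := by
  classical
  rw [coeff_one]
  split_ifs with h
  · simp [h]
  · rw [norm_zero]; positivity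

variable [IsUltrametricDist K]

theorem norm_coeff_mul_le {A M M' : ℝ} {f g : MvPowerSeries σ K} (hA : 0 ≤ A) (hM : 0 ≤ M)
    (hM' : 0 ≤ M') (hf : ∀ a, ‖coeff a f‖ ≤ M * A ^ a.degree)
    (hg : ∀ a, ‖coeff a g‖ ≤ M' * A ^ a.degree) (a : σ →₀ ℕ) :
    ‖coeff a (f * g)‖ ≤ M * M' * A ^ a.degree := by
  classical
  rw [coeff_mul]
  refine IsUltrametricDist.norm_sum_le_of_forall_le_of_nonneg (by positivity) fun p hp => ?_
  rw [← Finset.HasAntidiagonal.mem_antidiagonal.mp hp, map_add, norm_mul, pow_add]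
  calc ‖coeff p.1 f‖ * ‖coeff p.2 g‖ ≤ (M * A ^ p.1.degree) * (M' * A ^ p.2.degree) := by
        gcongr
        · exact hf _
        · exact hg _
    _ = _ := by ring

theorem norm_coeff_pow_le {A M : ℝ} {f : MvPowerSeries σ K} (hA : 0 ≤ A) (hM : 0 ≤ M)
    (hf : ∀ a, ‖coeff a f‖ ≤ M * A ^ a.degree) (e : ℕ) (a : σ →₀ ℕ) :
    ‖coeff a (f ^ e)‖ ≤ M ^ e * A ^ a.degree := by
  induction e generalizing a with
  | zero => simpa using norm_coeff_one_le (K := K) hA a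
  | succ e ih =>
    rw [pow_succ, pow_succ]
    exact norm_coeff_mul_le hA (by positivity) hM ih hf a

theorem norm_coeff_seriesMonomial_le {A M : ℝ} {H : σ → MvPowerSeries τ K} (hA : 0 ≤ A)
    (hM : 0 ≤ M) (hH : ∀ s a, ‖coeff a (H s)‖ ≤ M * A ^ a.degree) (b : σ →₀ ℕ) (a : τ →₀ ℕ) :
    ‖coeff a (seriesMonomial H b)‖ ≤ M ^ b.degree * A ^ a.degree := by
  induction b using Finsupp.induction_linear generalizing a with
  | zero => simpa using norm_coeff_one_le (K := K) hA a
  | add b c hb hc =>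
    rw [seriesMonomial_add, map_add, pow_add]
    exact norm_coeff_mul_le hA (by positivity) (by positivity) hb hc a
  | single s e =>
    rw [seriesMonomial_single, Finsupp.degree_single]
    exact norm_coeff_pow_le hA hM (hH s) e a

/-- A version of `norm_coeff_seriesMonomial_le` for coefficients of degree at most `N` which needs
bounds below degree `N` only. -/
theorem norm_coeff_seriesMonomial_le_of_lt {A M : ℝ} {H : σ → MvPowerSeries τ K} (hA : 0 ≤ A)
    (hM : 0 ≤ M) (hH0 : ∀ s, constantCoeff (H s) = 0) {N : ℕ}
    (hH : ∀ s a, a.degree < N → ‖coeff a (H s)‖ ≤ M * A ^ a.degree) {b : σ →₀ ℕ}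
    (hb : 2 ≤ b.degree) {a : τ →₀ ℕ} (ha : a.degree ≤ N) :
    ‖coeff a (seriesMonomial H b)‖ ≤ M ^ b.degree * A ^ a.degree := by
  classical
  -- Truncating `H` below degree `N` leaves these coefficients unchanged and makes the bound global.
  let H' : σ → MvPowerSeries τ K := fun s a => if a.degree < N then coeff a (H s) else 0
  have hH' : ∀ s a, coeff a (H' s) = if a.degree < N then coeff a (H s) else 0 :=
    fun s a => rfl
  have h0 : ∀ s, constantCoeff (H' s) = 0 := by
    intro s
    rw [← coeff_zero_eq_constantCoeff_apply, hH', coeff_zero_eq_constantCoeff_apply, hH0, ite_self]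
  rw [coeff_seriesMonomial_congr hH0 h0 (N := N) (fun s a ha => by rw [hH', if_pos ha]) hb ha]
  refine norm_coeff_seriesMonomial_le hA hM (fun s a => ?_) b a
  rw [hH']
  split_ifs with h
  · exact hH s a h
  · rw [norm_zero]; positivity

/-- The growth C^|b| of `f` cancels the factor C^(-|b|) of the b-th monomial in `H`; the ultrametric
inequality then makes the sum over b free. -/
theorem norm_coeff_subst_le {A C M : ℝ} {H : σ → MvPowerSeries τ K} (hH : HasSubst H)
    (hA : 0 ≤ A) (hC : 0 < C) (hM : 0 ≤ M) (hHb : ∀ s a, ‖coeff a (H s)‖ ≤ C⁻¹ * A ^ a.degree)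
    {f : MvPowerSeries σ K} (hf : ∀ a, ‖coeff a f‖ ≤ M * C ^ a.degree) (a : τ →₀ ℕ) :
    ‖coeff a (subst H f)‖ ≤ M * A ^ a.degree := by
  rw [coeff_subst hH]
  refine finsum_induction (fun x : K => ‖x‖ ≤ M * A ^ a.degree) ?_ ?_ ?_
  · rw [norm_zero]; positivity
  · exact fun x y hx hy => (IsUltrametricDist.norm_add_le_max x y).trans (max_le hx hy)
  · intro b
    have h := norm_coeff_seriesMonomial_le hA (by positivity) hHb b a
    rw [smul_eq_mul, norm_mul]
    calc _ ≤ (M * C ^ b.degree) * ((C⁻¹) ^ b.degree * A ^ a.degree) := by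
          gcongr
          · exact hf b
          · exact h
      _ = M * A ^ a.degree := by rw [inv_pow]; field_simp

end Bounds

/-! ### Series of geometric growth -/

open MvPowerSeries in
/-- The coefficients of `f` grow at most geometrically. -/
def HasGeometricGrowth {σ K : Type*} [NormedField K] (f : MvPowerSeries σ K) : Prop :=
  ∃ C : ℝ, 1 ≤ C ∧ ∀ a : σ →₀ ℕ, ‖coeff a f‖ ≤ C ^ (a.degree + 1)

namespace HasGeometricGrowth

open MvPowerSeries

variable {σ τ K : Type*} [NormedField K]

theorem of_le {f : MvPowerSeries σ K} {M C : ℝ} (hC : 0 ≤ C)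
    (h : ∀ a, ‖coeff a f‖ ≤ M * C ^ a.degree) : HasGeometricGrowth f := by
  refine ⟨max 1 (max M C), le_max_left _ _, fun a => (h a).trans ?_⟩
  rw [pow_succ']
  gcongr <;> simp

theorem exists_forall {ι : Type*} [Finite ι] {f : ι → MvPowerSeries σ K}
    (hf : ∀ i, HasGeometricGrowth (f i)) :
    ∃ C : ℝ, 1 ≤ C ∧ ∀ i a, ‖coeff a (f i)‖ ≤ C ^ (a.degree + 1) := by
  cases nonempty_fintype ι
  choose C hC h using hf
  refine ⟨1 + ∑ i, C i, ?_, fun i a => (h i a).trans ?_⟩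
  · linarith [Finset.sum_nonneg fun i (_ : i ∈ Finset.univ) => zero_le_one.trans (hC i)]
  · have := Finset.single_le_sum (f := C) (fun i _ => zero_le_one.trans (hC i)) (Finset.mem_univ i)
    gcongr
    · exact zero_le_one.trans (hC i)
    · linarith

theorem exists_le {f : MvPowerSeries σ K} (hf : HasGeometricGrowth f) :
    ∃ C : ℝ, 1 ≤ C ∧ ∀ a, ‖coeff a f‖ ≤ C * C ^ a.degree := by
  obtain ⟨C, hC, h⟩ := hf
  exact ⟨C, hC, fun a => by rw [← pow_succ']; exact h a⟩

/-- Without constant terms only |a| ≥ 1 matters, where |a| + 1 ≤ 2|a|; squaring `C` therefore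
removes the extra factor. -/
theorem exists_forall_le_pow {ι : Type*} [Finite ι] {f : ι → MvPowerSeries σ K}
    (hf : ∀ i, HasGeometricGrowth (f i)) (h0 : ∀ i, constantCoeff (f i) = 0) :
    ∃ C : ℝ, 1 ≤ C ∧ ∀ i a, ‖coeff a (f i)‖ ≤ C ^ a.degree := by
  obtain ⟨C, hC, h⟩ := exists_forall hf
  refine ⟨C ^ 2, one_le_pow₀ hC, fun i a => ?_⟩
  rcases Nat.eq_zero_or_pos a.degree with ha | ha
  · rw [VanishBelow.of_constantCoeff (h0 i) a (by omega), norm_zero]; positivity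
  · rw [← pow_mul]
    exact (h i a).trans (pow_le_pow_right₀ hC (by omega))

theorem neg {f : MvPowerSeries σ K} (hf : HasGeometricGrowth f) : HasGeometricGrowth (-f) := by
  simpa [HasGeometricGrowth] using hf

variable [IsUltrametricDist K]

theorem add {f g : MvPowerSeries σ K} (hf : HasGeometricGrowth f) (hg : HasGeometricGrowth g) :
    HasGeometricGrowth (f + g) := by
  obtain ⟨C, hC, hf⟩ := hf
  obtain ⟨D, hD, hg⟩ := hg
  refine ⟨max C D, hC.trans (le_max_left _ _), fun a => ?_⟩
  rw [map_add]
  refine (IsUltrametricDist.norm_add_le_max _ _).trans (max_le ((hf a).trans ?_) ((hg a).trans ?_))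
  · gcongr; exact le_max_left _ _
  · gcongr; exact le_max_right _ _

theorem sub {f g : MvPowerSeries σ K} (hf : HasGeometricGrowth f) (hg : HasGeometricGrowth g) :
    HasGeometricGrowth (f - g) := by
  rw [sub_eq_add_neg]; exact hf.add hg.neg

theorem mul {f g : MvPowerSeries σ K} (hf : HasGeometricGrowth f) (hg : HasGeometricGrowth g) :
    HasGeometricGrowth (f * g) := by
  obtain ⟨C, hC, hf⟩ := hf.exists_le
  obtain ⟨D, hD, hg⟩ := hg.exists_le
  refine of_le (M := C * D) (C := max C D) (by positivity)
    (norm_coeff_mul_le (by positivity) (by positivity) (by positivity) (fun a => (hf a).trans ?_)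
      (fun a => (hg a).trans ?_))
  · gcongr; exact le_max_left _ _
  · gcongr; exact le_max_right _ _

/-- As `H` has no constant terms, D^|a| ≤ C⁻¹ (C D)^|a| for |a| ≥ 1, which is the normalisation
required by `norm_coeff_subst_le`. -/
theorem subst [Finite σ] {H : σ → MvPowerSeries τ K} (hH : ∀ s, HasGeometricGrowth (H s))
    (hH0 : ∀ s, constantCoeff (H s) = 0) {f : MvPowerSeries σ K} (hf : HasGeometricGrowth f) :
    HasGeometricGrowth (subst H f) := by
  obtain ⟨C, hC, hf⟩ := hf.exists_le
  obtain ⟨D, hD, hH⟩ := exists_forall_le_pow hH hH0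
  have hC0 : 0 < C := by positivity
  refine of_le (M := C) (C := C * D) (by positivity) (norm_coeff_subst_le
    (hasSubst_of_constantCoeff_zero hH0) (by positivity) hC0 (by positivity) (fun s a => ?_) hf)
  rcases Nat.eq_zero_or_pos a.degree with ha | ha
  · rw [VanishBelow.of_constantCoeff (hH0 s) a (by omega), norm_zero]; positivity
  · refine (hH s a).trans ?_
    obtain ⟨n, hn⟩ := Nat.exists_eq_succ_of_ne_zero ha.ne'
    rw [hn, Nat.succ_eq_add_one, mul_pow, pow_succ C]
    have : C⁻¹ * (C ^ n * C * D ^ (n + 1)) = C ^ n * D ^ (n + 1) := by field_simp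
    rw [this]
    exact le_mul_of_one_le_left (by positivity) (one_le_pow₀ hC)

end HasGeometricGrowth

/-! ### Analyticity as geometric growth -/

section Analytic

open MvPowerSeries

variable {K : Type*} [NontriviallyNormedField K] {r : ℕ}

theorem exists_inv_norm_prod_le (x : Fin r → K) :
    ∃ C : ℝ, 1 ≤ C ∧ ∀ a : Fin r →₀ ℕ, ‖∏ i, x i ^ a i‖⁻¹ ≤ C ^ a.degree := by
  have hs : ∀ i, ‖x i‖⁻¹ ≤ 1 + ∑ j, ‖x j‖⁻¹ := fun i => by
    have := Finset.single_le_sum (f := fun j => ‖x j‖⁻¹) (fun j _ => by positivity)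
      (Finset.mem_univ i)
    linarith
  refine ⟨1 + ∑ j, ‖x j‖⁻¹, ?_, fun a => ?_⟩
  · linarith [Finset.sum_nonneg fun j (_ : j ∈ Finset.univ) => (inv_nonneg.mpr (norm_nonneg (x j)))]
  · rw [norm_prod, ← Finset.prod_inv_distrib, Finsupp.degree_eq_sum, ← Finset.prod_pow_eq_pow_sum]
    refine Finset.prod_le_prod (fun i _ => by positivity) fun i _ => ?_
    rw [norm_pow, ← inv_pow]
    exact pow_le_pow_left₀ (by positivity) (hs i) _

/-- Convergence at a single point with all coordinates nonzero bounds the terms, hence the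
coefficients geometrically. Conversely, in a complete ultrametric field it suffices that the terms
tend to zero, which holds on a small polydisc. -/
theorem isAnalyticSeries_iff [IsUltrametricDist K] [CompleteSpace K] {f : MvPowerSeries (Fin r) K} :
    IsAnalyticSeries f ↔ HasGeometricGrowth f := by
  constructor
  · rintro ⟨ε, hε, h⟩
    choose x hx0 hx using fun i => NormedField.exists_norm_lt K (hε i)
    have hs := (h x hx).tendsto_cofinite_zero
    obtain ⟨C, hC, hxC⟩ := exists_inv_norm_prod_le x
    have hfin : {a : Fin r →₀ ℕ | ¬ ‖coeff a f * ∏ i, x i ^ a i‖ < 1}.Finite := by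
      have := hs.norm.eventually (gt_mem_nhds (by simp : ‖(0 : K)‖ < 1))
      exact this
    obtain ⟨M, hM⟩ := (hfin.image fun a => ‖coeff a f * ∏ i, x i ^ a i‖).bddAbove
    have hb : ∀ a, ‖coeff a f * ∏ i, x i ^ a i‖ ≤ max M 1 := by
      intro a
      by_cases ha : ‖coeff a f * ∏ i, x i ^ a i‖ < 1
      · exact ha.le.trans (le_max_right _ _)
      · exact (hM ⟨a, ha, rfl⟩).trans (le_max_left _ _)
    refine HasGeometricGrowth.of_le (M := max M 1) (C := C) (by positivity) fun a => ?_
    have hp : 0 < ‖∏ i, x i ^ a i‖ := by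
      rw [norm_prod]
      exact Finset.prod_pos fun i _ => by rw [norm_pow]; exact pow_pos (hx0 i) _
    have h1 := hb a
    rw [norm_mul] at h1
    calc ‖coeff a f‖ = ‖coeff a f‖ * ‖∏ i, x i ^ a i‖ * ‖∏ i, x i ^ a i‖⁻¹ := by field_simp
      _ ≤ max M 1 * C ^ a.degree := by gcongr; exact hxC a
  · rintro ⟨C, hC, h⟩
    have hC0 : 0 < C := by positivity
    -- On this polydisc the term of exponent a is at most C 2^(-|a|), and only finitely many
    -- exponents have a given degree.
    refine ⟨fun _ => (2 * C)⁻¹, fun _ => by positivity, fun x hx => ?_⟩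
    refine NonarchimedeanAddGroup.summable_of_tendsto_cofinite_zero ?_
    have hbound : ∀ a : Fin r →₀ ℕ, ‖coeff a f * ∏ i, x i ^ a i‖ ≤ C * (1 / 2 : ℝ) ^ a.degree := by
      intro a
      have : ‖∏ i, x i ^ a i‖ ≤ ((2 * C)⁻¹) ^ a.degree := by
        rw [norm_prod, Finsupp.degree_eq_sum, ← Finset.prod_pow_eq_pow_sum]
        refine Finset.prod_le_prod (fun i _ => by positivity) fun i _ => ?_
        rw [norm_pow]
        exact pow_le_pow_left₀ (by positivity) (hx i).le _
      rw [norm_mul]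
      calc _ ≤ C ^ (a.degree + 1) * ((2 * C)⁻¹) ^ a.degree := by
            gcongr
            exact h a
        _ = _ := by rw [mul_inv, mul_pow, pow_succ, one_div, inv_pow C]; field_simp
    have hdeg : Filter.Tendsto (fun a : Fin r →₀ ℕ => a.degree) Filter.cofinite Filter.atTop := by
      rw [← Nat.cofinite_eq_atTop]
      refine Filter.Tendsto.cofinite_of_finite_preimage_singleton fun n => ?_
      exact Finsupp.finite_of_degree_eq n
    refine squeeze_zero_norm hbound ?_
    have h2 := (tendsto_pow_atTop_nhds_zero_of_lt_one (r := (1 / 2 : ℝ)) (by norm_num)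
      (by norm_num)).comp hdeg
    simpa using h2.const_mul C

end Analytic

section Ultrametric

theorem norm_sub_le_max_norm {K : Type*} [SeminormedAddCommGroup K] [IsUltrametricDist K]
    (x y : K) : ‖x - y‖ ≤ max ‖x‖ ‖y‖ := by
  rw [sub_eq_add_neg, ← norm_neg y]
  exact IsUltrametricDist.norm_add_le_max x (-y)

end Ultrametric

/-! ### Coefficients of composites with diagonal linear part -/

section Formulas

open MvPowerSeries

variable {K : Type*} [Field K] {r : ℕ}

/-- The exponents of total degree less than `n`. -/
noncomputable def exponentsLT (r n : ℕ) : Finset (Fin r →₀ ℕ) :=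
  (Finsupp.finite_of_degree_lt n).toFinset

@[simp] theorem mem_exponentsLT {n : ℕ} {a : Fin r →₀ ℕ} : a ∈ exponentsLT r n ↔ a.degree < n := by
  simp [exponentsLT]

/-- The b-th monomial in `H` has order at least |b|, so only the exponents with |b| ≤ |a|
contribute. -/
theorem coeff_subst_eq_sum {H : Fin r → MvPowerSeries (Fin r) K}
    (hH : ∀ s, constantCoeff (H s) = 0) (f : MvPowerSeries (Fin r) K) (a : Fin r →₀ ℕ) :
    coeff a (subst H f) =
      ∑ b ∈ exponentsLT r (a.degree + 1), coeff b f * coeff a (seriesMonomial H b) := by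
  rw [coeff_subst (hasSubst_of_constantCoeff_zero hH)]
  refine finsum_eq_sum_of_support_subset _ fun b hb => ?_
  simp only [Finset.mem_coe, mem_exponentsLT]
  by_contra h
  refine hb ?_
  have := vanishBelow_seriesMonomial hH b a (by omega)
  rw [seriesMonomial] at this
  simp only [this, smul_zero]

/-- The monomial `∏ l_i ^ a_i`. -/
def eigenvalue (l : Fin r → K) (a : Fin r →₀ ℕ) : K := ∏ i, l i ^ a i

@[simp] theorem eigenvalue_single (l : Fin r → K) (i : Fin r) :
    eigenvalue l (Finsupp.single i 1) = l i := by
  classical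
  rw [eigenvalue, Finset.prod_eq_single i]
  · simp
  · intro j _ hj; simp [Finsupp.single_eq_of_ne hj]
  · simp

theorem seriesMonomial_diagonal (l : Fin r → K) (b : Fin r →₀ ℕ) :
    seriesMonomial (fun i => monomial (Finsupp.single i 1) (l i)) b =
      monomial b (eigenvalue l b) := by
  classical
  rw [seriesMonomial, Finsupp.prod_fintype _ _ (fun _ => pow_zero _), eigenvalue]
  simp only [monomial_pow]
  have : ∀ s : Finset (Fin r), ∏ i ∈ s, (monomial (b i • Finsupp.single i 1) (l i ^ b i)) =
      monomial (∑ i ∈ s, b i • Finsupp.single i 1) (∏ i ∈ s, l i ^ b i) := by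
    intro s
    induction s using Finset.induction_on with
    | empty => simp
    | insert i s hi ih =>
      rw [Finset.prod_insert hi, ih, monomial_mul_monomial, Finset.sum_insert hi,
        Finset.prod_insert hi]
  rw [this]
  congr 1
  ext j
  simp

theorem exists_eq_single_of_degree_eq_one {a : Fin r →₀ ℕ} (ha : a.degree = 1) :
    ∃ i, a = Finsupp.single i 1 := by
  have h : ∃ i, a i ≠ 0 := by
    by_contra! h
    have : a = 0 := Finsupp.ext h
    simp [this] at ha
  obtain ⟨i, hi⟩ := h
  refine ⟨i, ?_⟩
  have h1 : Finsupp.single i 1 ≤ a := by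
    rw [Finsupp.single_le_iff]; omega
  obtain ⟨c, hc⟩ := exists_add_of_le h1
  have h2 := congrArg Finsupp.degree hc
  rw [map_add, Finsupp.degree_single, ha] at h2
  have : c = 0 := (Finsupp.degree_eq_zero_iff c).mp (by omega)
  rw [hc, this, add_zero]

/-- Monomials of degree at least `|a|` in a map with diagonal linear part. -/
theorem FormalMap.HasDiagonalLinearPart.coeff_seriesMonomial {F : FormalMap K r} {l : Fin r → K}
    (hF : F.HasDiagonalLinearPart l) {a b : Fin r →₀ ℕ} (hab : a.degree ≤ b.degree) :
    coeff a (seriesMonomial F.comp b) = if a = b then eigenvalue l b else 0 := by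
  classical
  have h := vanishBelow_seriesMonomial_sub (n := 1) F.map_zero
    (H' := fun i => monomial (Finsupp.single i 1) (l i)) (fun i => ?_) (fun i c hc => ?_) b a
    (by omega)
  · rw [map_sub, sub_eq_zero, seriesMonomial_diagonal, coeff_monomial] at h
    exact h
  · rw [← coeff_zero_eq_constantCoeff_apply, coeff_monomial, if_neg]
    intro h
    simpa using congrArg Finsupp.degree h
  · rw [map_sub, sub_eq_zero, coeff_monomial]
    rcases Nat.lt_or_ge c.degree 1 with h | h
    · have hc0 : c = 0 := (Finsupp.degree_eq_zero_iff c).mp (by omega)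
      subst hc0
      rw [coeff_zero_eq_constantCoeff_apply, F.map_zero, if_neg]
      intro h
      simpa using congrArg Finsupp.degree h
    · obtain ⟨j, rfl⟩ := exists_eq_single_of_degree_eq_one (show c.degree = 1 by omega)
      rw [hF i j]
      by_cases hij : i = j
      · subst hij; simp
      · rw [if_neg hij, if_neg]
        intro h
        exact hij ((Finsupp.single_left_injective one_ne_zero) h).symm

/-- Coefficients of `f ∘ F` when `F` has a diagonal linear part. -/
theorem FormalMap.HasDiagonalLinearPart.coeff_subst {F : FormalMap K r} {l : Fin r → K}
    (hF : F.HasDiagonalLinearPart l) (f : MvPowerSeries (Fin r) K) (a : Fin r →₀ ℕ) :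
    coeff a (subst F.comp f) = eigenvalue l a * coeff a f +
      ∑ b ∈ exponentsLT r a.degree, coeff b f * coeff a (seriesMonomial F.comp b) := by
  classical
  rw [coeff_subst_eq_sum F.map_zero]
  have hsub : exponentsLT r a.degree ⊆ exponentsLT r (a.degree + 1) := fun b hb => by
    simp only [mem_exponentsLT] at hb ⊢; omega
  rw [← Finset.sum_sdiff hsub, Finset.sum_eq_single a]
  · rw [hF.coeff_seriesMonomial le_rfl, if_pos rfl, mul_comm]
  · intro b hb hba
    simp only [Finset.mem_sdiff, mem_exponentsLT, not_lt] at hb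
    rw [hF.coeff_seriesMonomial hb.2, if_neg hba.symm, mul_zero]
  · intro h
    simp at h

/-- Coefficients of `G_i ∘ H` when `G` has a diagonal linear part. -/
theorem FormalMap.HasDiagonalLinearPart.coeff_subst_comp {G : FormalMap K r} {l : Fin r → K}
    (hG : G.HasDiagonalLinearPart l) {H : Fin r → MvPowerSeries (Fin r) K}
    (hH : ∀ s, constantCoeff (H s) = 0) (i : Fin r) (a : Fin r →₀ ℕ) :
    coeff a (subst H (G.comp i)) = l i * coeff a (H i) +
      ∑ b ∈ exponentsLT r (a.degree + 1) with 2 ≤ b.degree,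
        coeff b (G.comp i) * coeff a (seriesMonomial H b) := by
  classical
  rw [coeff_subst_eq_sum hH, ← Finset.sum_filter_not_add_sum_filter _ (fun b => 2 ≤ b.degree)]
  congr 1
  have hval : ∀ b : Fin r →₀ ℕ, b.degree < 2 → b ≠ Finsupp.single i 1 →
      coeff b (G.comp i) = 0 := by
    intro b hb hbi
    rcases Nat.lt_or_ge b.degree 1 with h | h
    · exact VanishBelow.of_constantCoeff (G.map_zero i) b h
    · obtain ⟨j, rfl⟩ := exists_eq_single_of_degree_eq_one (show b.degree = 1 by omega)
      rw [hG i j, if_neg]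
      rintro rfl
      exact hbi rfl
  rw [Finset.sum_eq_single (Finsupp.single i 1)]
  · rw [hG i i, if_pos rfl, seriesMonomial_single, pow_one]
  · intro b hb hbi
    rw [Finset.mem_filter, not_le] at hb
    rw [hval b hb.2 hbi, zero_mul]
  · intro h
    simp only [Finset.mem_filter, mem_exponentsLT, Finsupp.degree_single] at h
    have : a.degree = 0 := by omega
    rw [(Finsupp.degree_eq_zero_iff a).mp this, seriesMonomial_single, pow_one,
      coeff_zero_eq_constantCoeff_apply, hH, mul_zero]

/-- The nonlinear part of `coeff a (f ∘ H)` depends only on the coefficients of `H` below `|a|`. -/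
theorem sum_coeff_seriesMonomial_congr {H H' : Fin r → MvPowerSeries (Fin r) K}
    (hH : ∀ s, constantCoeff (H s) = 0) (hH' : ∀ s, constantCoeff (H' s) = 0)
    {a : Fin r →₀ ℕ} (h : ∀ s b, b.degree < a.degree → coeff b (H s) = coeff b (H' s))
    (n : ℕ) (f : MvPowerSeries (Fin r) K) :
    ∑ b ∈ exponentsLT r n with 2 ≤ b.degree, coeff b f * coeff a (seriesMonomial H b) =
      ∑ b ∈ exponentsLT r n with 2 ≤ b.degree, coeff b f * coeff a (seriesMonomial H' b) := by
  refine Finset.sum_congr rfl fun b hb => ?_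
  rw [Finset.mem_filter] at hb
  rw [coeff_seriesMonomial_congr hH hH' h hb.2 le_rfl]

end Formulas

/-! ### Bounds for the lower-order terms of the conjugation equation -/

section FormulaBounds

open MvPowerSeries

variable {K : Type*} [NormedField K] {r : ℕ}

/-- A normalisation of the growth of a map with linear part of norm at most one. -/
theorem exists_norm_coeff_le_inv_mul_pow {F : FormalMap K r} {l : Fin r → K}
    (hF : F.HasDiagonalLinearPart l) (hl : ∀ i, ‖l i‖ ≤ 1)
    (hg : ∀ i, HasGeometricGrowth (F.comp i)) :
    ∃ C : ℝ, 1 ≤ C ∧ ∀ D, C ≤ D → ∀ s b, ‖coeff b (F.comp s)‖ ≤ D⁻¹ * D ^ b.degree := by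
  obtain ⟨C, hC, h⟩ := HasGeometricGrowth.exists_forall_le_pow hg F.map_zero
  refine ⟨C ^ 2, one_le_pow₀ hC, fun D hD s b => ?_⟩
  have hD1 : 1 ≤ D := (one_le_pow₀ hC).trans hD
  have hD0 : 0 < D := by positivity
  rcases Nat.lt_or_ge b.degree 1 with hb | hb
  · rw [VanishBelow.of_constantCoeff (F.map_zero s) b hb, norm_zero]; positivity
  obtain ⟨n, hn⟩ : ∃ n, b.degree = n + 1 := ⟨b.degree - 1, by omega⟩
  have hr : D⁻¹ * D ^ b.degree = D ^ n := by rw [hn, pow_succ]; field_simp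
  rw [hr]
  rcases Nat.eq_zero_or_pos n with h0 | h0
  · subst h0
    obtain ⟨j, rfl⟩ := exists_eq_single_of_degree_eq_one hn
    rw [hF s j, pow_zero]
    split_ifs
    · exact hl s
    · simp
  · refine (h s b).trans ?_
    -- For n ≥ 1 one has n + 1 ≤ 2n, so `C ^ 2` is large enough. The remaining case n = 0 is the
    -- linear part, where the bound is exactly 1.
    calc C ^ b.degree ≤ C ^ (2 * n) := pow_le_pow_right₀ hC (by omega)
      _ = (C ^ 2) ^ n := pow_mul _ _ _
      _ ≤ D ^ n := by gcongr

variable [IsUltrametricDist K]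

/-- All terms have degree at least two in `H`, so the scale `ρ` enters squared. For small `ρ` this
beats a fixed multiple of `ρ`, which lets an induction with bound ρ A^|a| close. -/
theorem norm_sum_coeff_seriesMonomial_le {H : Fin r → MvPowerSeries (Fin r) K}
    (hH : ∀ s, constantCoeff (H s) = 0) {A C ρ : ℝ} (hA : 0 ≤ A) (hC : 0 ≤ C) (hρ : 0 ≤ ρ)
    (hCρ : C * ρ ≤ 1) {a : Fin r →₀ ℕ}
    (h : ∀ s b, b.degree < a.degree → ‖coeff b (H s)‖ ≤ ρ * A ^ b.degree) (n : ℕ)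
    {f : MvPowerSeries (Fin r) K} (hf : ∀ b, ‖coeff b f‖ ≤ C ^ b.degree) :
    ‖∑ b ∈ exponentsLT r n with 2 ≤ b.degree, coeff b f * coeff a (seriesMonomial H b)‖ ≤
      (C * ρ) ^ 2 * A ^ a.degree := by
  refine IsUltrametricDist.norm_sum_le_of_forall_le_of_nonneg (by positivity) fun b hb => ?_
  rw [Finset.mem_filter] at hb
  have h1 := norm_coeff_seriesMonomial_le_of_lt hA hρ hH h hb.2 le_rfl
  rw [norm_mul]
  calc _ ≤ C ^ b.degree * (ρ ^ b.degree * A ^ a.degree) := by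
        gcongr
        exact hf b
    _ = (C * ρ) ^ b.degree * A ^ a.degree := by ring
    _ ≤ _ := by
        gcongr ?_ * _
        exact pow_le_pow_of_le_one (by positivity) hCρ hb.2

/-- The b-th monomial in `F` has a-coefficient at most C^(|a|-|b|). Replacing A^(|a|-|b|) by this
gains at least one factor C/A because |b| < |a|; a large `A` thus makes the sum as small as needed.
-/
theorem norm_sum_coeff_le {F : Fin r → MvPowerSeries (Fin r) K} {A C ρ : ℝ} (hC : 0 < C)
    (hCA : C ≤ A) (hρ : 0 ≤ ρ) (hF : ∀ s b, ‖coeff b (F s)‖ ≤ C⁻¹ * C ^ b.degree)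
    {a : Fin r →₀ ℕ} {f : MvPowerSeries (Fin r) K}
    (hf : ∀ b, b.degree < a.degree → ‖coeff b f‖ ≤ ρ * A ^ b.degree) :
    ‖∑ b ∈ exponentsLT r a.degree, coeff b f * coeff a (seriesMonomial F b)‖ ≤
      C / A * ρ * A ^ a.degree := by
  have hA : 0 < A := hC.trans_le hCA
  refine IsUltrametricDist.norm_sum_le_of_forall_le_of_nonneg (by positivity) fun b hb => ?_
  rw [mem_exponentsLT] at hb
  have h1 := norm_coeff_seriesMonomial_le hC.le (by positivity) hF b a
  rw [norm_mul]
  obtain ⟨d, hd⟩ := Nat.exists_eq_add_of_lt hb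
  calc _ ≤ (ρ * A ^ b.degree) * ((C⁻¹) ^ b.degree * C ^ a.degree) := by
        gcongr
        exact hf b hb
    _ = ρ * A ^ b.degree * C * C ^ d := by
        rw [hd, pow_succ, pow_add, inv_pow]; field_simp
    _ ≤ ρ * A ^ b.degree * C * A ^ d := by gcongr
    _ = _ := by rw [hd, pow_succ, pow_add]; field_simp

end FormulaBounds

/-- An operator on families for which `T z i` depends only on the `z j` with `d j < d i` has a
fixed point. -/
theorem exists_fixedPoint_of_local {ι α : Type*} [Nonempty α] (d : ι → ℕ) (T : (ι → α) → ι → α)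
    (hT : ∀ z z' i, (∀ j, d j < d i → z j = z' j) → T z i = T z' i) : ∃ z, T z = z := by
  inhabit α
  -- Entries of level less than N are stationary from the N-th iterate on, whatever the starting
  -- family.
  have key : ∀ N m n i, d i < N → N ≤ m → N ≤ n →
      T^[m] (fun _ => default) i = T^[n] (fun _ => default) i := by
    intro N
    induction N with
    | zero => intro m n i hi; omega
    | succ N ih =>
      intro m n i hi hm hn
      obtain ⟨m, rfl⟩ : ∃ m', m = m' + 1 := ⟨m - 1, by omega⟩
      obtain ⟨n, rfl⟩ : ∃ n', n = n' + 1 := ⟨n - 1, by omega⟩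
      rw [Function.iterate_succ_apply', Function.iterate_succ_apply']
      exact hT _ _ _ fun j hj => ih m n j (by omega) (by omega) (by omega)
  refine ⟨fun i => T^[d i + 1] (fun _ => default) i, funext fun i => ?_⟩
  rw [Function.iterate_succ_apply']
  refine hT _ _ _ fun j hj => ?_
  exact key (d j + 1) _ _ j (by omega) le_rfl (by omega)

namespace FormalMap

open MvPowerSeries

/-! ### The composition monoid and formal inverses -/

section Algebra

variable {K : Type*} [Field K] {r : ℕ}

theorem hasSubst (F : FormalMap K r) : HasSubst F.comp :=
  hasSubst_of_constantCoeff_zero F.map_zero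

/-- Since the product is `circ` and the unit is `idMap` by definition, inverses and conjugations can
be handled as monoid identities. -/
noncomputable instance : Monoid (FormalMap K r) where
  mul := circ
  one := idMap
  mul_assoc F G H := by
    ext1
    funext k
    exact (subst_comp_subst_apply G.hasSubst H.hasSubst (F.comp k))
  one_mul F := by
    ext1
    funext k
    exact subst_X F.hasSubst k
  mul_one F := by
    ext1
    funext k
    exact congrFun subst_self (F.comp k)

theorem mul_comp (F G : FormalMap K r) (k : Fin r) :
    (F * G).comp k = subst G.comp (F.comp k) := rfl

theorem one_comp (k : Fin r) : (1 : FormalMap K r).comp k = X k := rfl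

/-- The map with prescribed coefficients in positive degree. -/
noncomputable def ofCoeffs (z : Fin r × (Fin r →₀ ℕ) → K) : FormalMap K r where
  comp i a := if a.degree = 0 then 0 else z (i, a)
  map_zero i := by
    change (if (0 : Fin r →₀ ℕ).degree = 0 then (0 : K) else z (i, 0)) = 0
    simp

theorem coeff_ofCoeffs (z : Fin r × (Fin r →₀ ℕ) → K) (i : Fin r) (a : Fin r →₀ ℕ) :
    coeff a ((ofCoeffs z).comp i) = if a.degree = 0 then 0 else z (i, a) := rfl

theorem coeff_eq_zero_of_degree_eq_zero (F : FormalMap K r) (i : Fin r) {a : Fin r →₀ ℕ}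
    (ha : a.degree = 0) : coeff a (F.comp i) = 0 :=
  VanishBelow.of_constantCoeff (F.map_zero i) a (by omega)

theorem coeff_single_X (i j : Fin r) :
    coeff (Finsupp.single j 1) (X i : MvPowerSeries (Fin r) K) = if i = j then 1 else 0 := by
  classical
  rw [coeff_X]
  simp only [(Finsupp.single_left_injective one_ne_zero).eq_iff, eq_comm]

/-- In degree a, the equation H ∘ H' = id reads l_i h'_{i,a} = known terms, the nonlinear part
involving only coefficients of `H'` below |a|. It is solved degree by degree, as a fixed point of a
local operator. -/
theorem exists_right_inverse {H : FormalMap K r} {l : Fin r → K} (hl : ∀ i, l i ≠ 0)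
    (hH : H.HasDiagonalLinearPart l) : ∃ H', H * H' = 1 ∧ H'.HasDiagonalLinearPart l⁻¹ := by
  classical
  let T : (Fin r × (Fin r →₀ ℕ) → K) → Fin r × (Fin r →₀ ℕ) → K := fun z p =>
    if p.2.degree = 0 then 0 else (l p.1)⁻¹ * (coeff p.2 (X p.1 : MvPowerSeries (Fin r) K) -
      ∑ b ∈ exponentsLT r (p.2.degree + 1) with 2 ≤ b.degree,
        coeff b (H.comp p.1) * coeff p.2 (seriesMonomial (ofCoeffs z).comp b))
  obtain ⟨z, hz⟩ := exists_fixedPoint_of_local (fun p : Fin r × (Fin r →₀ ℕ) => p.2.degree) T (by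
    intro z z' p hp
    simp only [T]
    rw [sum_coeff_seriesMonomial_congr (ofCoeffs z).map_zero (ofCoeffs z').map_zero]
    intro s b hb
    rw [coeff_ofCoeffs, coeff_ofCoeffs, hp (s, b) hb])
  have hmul : H * ofCoeffs z = 1 := by
    ext i a
    rw [mul_comp, one_comp, hH.coeff_subst_comp (ofCoeffs z).map_zero]
    rcases Nat.eq_zero_or_pos a.degree with ha | ha
    · have ha0 := (Finsupp.degree_eq_zero_iff a).mp ha
      rw [coeff_ofCoeffs, if_pos ha, mul_zero, zero_add, Finset.sum_eq_zero]
      · simp [ha0]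
      · intro b hb
        rw [Finset.mem_filter, mem_exponentsLT] at hb
        omega
    · have := congrFun hz (i, a)
      simp only [T] at this
      rw [if_neg ha.ne'] at this
      rw [coeff_ofCoeffs, if_neg ha.ne', ← this, mul_inv_cancel_left₀ (hl i), sub_add_cancel]
  refine ⟨_, hmul, fun i j => ?_⟩
  have h := congrArg (fun G : FormalMap K r => coeff (Finsupp.single j 1) (G.comp i)) hmul
  simp only [mul_comp, one_comp] at h
  rw [hH.coeff_subst_comp (ofCoeffs z).map_zero, Finset.sum_eq_zero, add_zero, coeff_single_X] at h
  · rw [← inv_mul_cancel_left₀ (hl i) (coeff _ _), h]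
    split_ifs <;> simp
  · intro b hb
    rw [Finset.mem_filter, mem_exponentsLT, Finsupp.degree_single] at hb
    omega

/-- The right inverse has itself a right inverse, which must be `H`; so the inverse is two-sided. -/
theorem exists_inverse {H : FormalMap K r} {l : Fin r → K} (hl : ∀ i, l i ≠ 0)
    (hH : H.HasDiagonalLinearPart l) :
    ∃ H', H * H' = 1 ∧ H' * H = 1 ∧ H'.HasDiagonalLinearPart l⁻¹ := by
  obtain ⟨H', h1, hH'⟩ := exists_right_inverse hl hH
  obtain ⟨H'', h2, -⟩ := exists_right_inverse (fun i => inv_ne_zero (hl i)) hH'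
  have : H = H'' := left_inv_eq_right_inv h1 h2
  exact ⟨H', h1, this ▸ h2, hH'⟩

/-- A conjugation between maps with the same diagonal linear part with distinct eigenvalues has a
diagonal linear part. -/
theorem exists_hasDiagonalLinearPart {F G H : FormalMap K r} {l : Fin r → K}
    (hl : Function.Injective l) (hF : F.HasDiagonalLinearPart l)
    (hG : G.HasDiagonalLinearPart l) (h : H * F = G * H) :
    ∃ m, H.HasDiagonalLinearPart m := by
  refine ⟨fun i => coeff (Finsupp.single i 1) (H.comp i), fun i j => ?_⟩
  split_ifs with hij
  · rw [hij]
  have he := congrArg (fun G : FormalMap K r => coeff (Finsupp.single j 1) (G.comp i)) h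
  simp only [mul_comp] at he
  -- In degree one the conjugation equation is l_j h_{ij} = l_i h_{ij}.
  rw [hG.coeff_subst_comp H.map_zero, hF.coeff_subst, Finset.sum_eq_zero, Finset.sum_eq_zero,
    add_zero, add_zero, eigenvalue_single] at he
  · by_contra h0
    exact hij (hl (mul_right_cancel₀ h0 he)).symm
  · intro b hb
    rw [Finset.mem_filter, mem_exponentsLT, Finsupp.degree_single] at hb
    omega
  · intro b hb
    rw [mem_exponentsLT, Finsupp.degree_single] at hb
    rw [H.coeff_eq_zero_of_degree_eq_zero i (by omega), zero_mul]

end Algebra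

/-! ### Choice of scales, and decay of the eigenvalue monomials -/

section Norm

variable {K : Type*} [NormedField K] {r : ℕ}

/-- This picks the scale at which the quadratic bound of `norm_sum_coeff_seriesMonomial_le` is
dominated by a divisor of norm `δ`. -/
theorem exists_pos_mul_sq_le {C δ : ℝ} (hC : 0 < C) (hδ : 0 < δ) :
    ∃ ρ : ℝ, 0 < ρ ∧ C * ρ ≤ 1 ∧ (C * ρ) ^ 2 ≤ δ * ρ := by
  refine ⟨min (1 / C) (δ / C ^ 2), by positivity, ?_, ?_⟩
  · calc C * min (1 / C) (δ / C ^ 2) ≤ C * (1 / C) := by gcongr; exact min_le_left _ _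
      _ = 1 := by field_simp
  · set ρ := min (1 / C) (δ / C ^ 2)
    have hρ : 0 < ρ := by positivity
    calc (C * ρ) ^ 2 = C ^ 2 * ρ * ρ := by ring
      _ ≤ C ^ 2 * (δ / C ^ 2) * ρ := by gcongr; exact min_le_right _ _
      _ = δ * ρ := by field_simp

theorem exists_pos_forall_le {l : Fin r → K} (hl : ∀ i, l i ≠ 0) :
    ∃ δ : ℝ, 0 < δ ∧ ∀ i, δ ≤ ‖l i‖ := by
  rcases isEmpty_or_nonempty (Fin r) with h | h
  · exact ⟨1, one_pos, fun i => h.elim i⟩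
  · obtain ⟨i, hi⟩ := Finite.exists_min fun i => ‖l i‖
    exact ⟨‖l i‖, norm_pos_iff.mpr (hl i), hi⟩

theorem exists_norm_eigenvalue_lt {l : Fin r → K} (hl : ∀ i, ‖l i‖ < 1) {δ : ℝ} (hδ : 0 < δ) :
    ∃ N, ∀ a : Fin r →₀ ℕ, N ≤ a.degree → ‖eigenvalue l a‖ < δ := by
  obtain ⟨q, hq0, hq1, hq⟩ : ∃ q : ℝ, 0 ≤ q ∧ q < 1 ∧ ∀ i, ‖l i‖ ≤ q := by
    rcases isEmpty_or_nonempty (Fin r) with h | h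
    · exact ⟨0, le_rfl, one_pos, fun i => h.elim i⟩
    · obtain ⟨i, hi⟩ := Finite.exists_max fun i => ‖l i‖
      exact ⟨‖l i‖, norm_nonneg _, hl i, hi⟩
  obtain ⟨N, hN⟩ := exists_pow_lt_of_lt_one hδ hq1
  refine ⟨N, fun a ha => lt_of_le_of_lt ?_ hN⟩
  rw [eigenvalue, norm_prod]
  calc ∏ i, ‖l i ^ a i‖ ≤ ∏ i, q ^ a i := by
        refine Finset.prod_le_prod (fun i _ => norm_nonneg _) fun i _ => ?_
        rw [norm_pow]
        exact pow_le_pow_left₀ (norm_nonneg _) (hq i) _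
    _ = q ^ a.degree := by rw [Finset.prod_pow_eq_pow_sum, Finsupp.degree_eq_sum]
    _ ≤ q ^ N := pow_le_pow_of_le_one hq0 hq1.le ha

end Norm

section Analytic

variable {K : Type*} [NontriviallyNormedField K] [IsUltrametricDist K] [CompleteSpace K] {r : ℕ}

theorem isAnalytic_iff {F : FormalMap K r} :
    F.IsAnalytic ↔ ∀ i, HasGeometricGrowth (F.comp i) :=
  forall_congr' fun _ => isAnalyticSeries_iff

theorem IsAnalytic.mul {F G : FormalMap K r} (hF : F.IsAnalytic) (hG : G.IsAnalytic) :
    (F * G).IsAnalytic := by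
  rw [isAnalytic_iff] at *
  exact fun i => HasGeometricGrowth.subst hG G.map_zero (hF i)

/-- Induction on the degree with bound ρ A^|a|: in l_i h'_{i,a} = id_{i,a} - nonlinear terms, the
smallness of `ρ` controls the nonlinear terms and the size of `A` controls the identity. -/
theorem IsAnalytic.of_mul_eq_one {H H' : FormalMap K r} {l : Fin r → K} (hl : ∀ i, l i ≠ 0)
    (hlin : H.HasDiagonalLinearPart l) (hH : H.IsAnalytic) (h : H * H' = 1) : H'.IsAnalytic := by
  classical
  rw [isAnalytic_iff] at *
  obtain ⟨C, hC, hHC⟩ := HasGeometricGrowth.exists_forall_le_pow hH H.map_zero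
  obtain ⟨δ, hδ, hlδ⟩ := exists_pos_forall_le hl
  obtain ⟨ρ, hρ, hCρ, hρδ⟩ := exists_pos_mul_sq_le (zero_lt_one.trans_le hC) hδ
  -- Chosen so that δ ρ A ≥ 1, the size of the linear coefficients of the identity.
  set A : ℝ := max 1 (1 / (δ * ρ))
  have hA1 : 1 ≤ A := le_max_left _ _
  have hA0 : 0 < A := by positivity
  have key : ∀ N, ∀ i (a : Fin r →₀ ℕ), a.degree = N →
      ‖coeff a (H'.comp i)‖ ≤ ρ * A ^ a.degree := by
    intro N
    induction N using Nat.strong_induction_on with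
    | _ N ih =>
      intro i a ha
      rcases Nat.eq_zero_or_pos a.degree with h0 | h0
      · rw [H'.coeff_eq_zero_of_degree_eq_zero i h0, norm_zero]; positivity
      have he := congrArg (fun G : FormalMap K r => coeff a (G.comp i)) h
      simp only [mul_comp, one_comp] at he
      rw [hlin.coeff_subst_comp H'.map_zero, ← eq_sub_iff_add_eq] at he
      have hb := norm_sum_coeff_seriesMonomial_le (a := a) H'.map_zero hA0.le (by positivity) hρ.le
        hCρ (fun s b hb => ih b.degree (by omega) s b rfl) (a.degree + 1) (hHC i)
      have hX : ‖coeff a (X i : MvPowerSeries (Fin r) K)‖ ≤ δ * ρ * A ^ a.degree := by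
        rw [coeff_X]
        split_ifs
        · rw [norm_one]
          calc (1 : ℝ) = δ * ρ * (1 / (δ * ρ)) := by field_simp
            _ ≤ δ * ρ * A := by gcongr; exact le_max_right _ _
            _ ≤ δ * ρ * A ^ a.degree := by gcongr; exact le_self_pow₀ hA1 h0.ne'
        · rw [norm_zero]; positivity
      have h1 : ‖l i * coeff a (H'.comp i)‖ ≤ δ * ρ * A ^ a.degree := by
        rw [he]
        refine (norm_sub_le_max_norm _ _).trans (max_le hX (hb.trans ?_))
        gcongr
      rw [norm_mul, mul_assoc] at h1
      exact le_of_mul_le_mul_left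
        ((mul_le_mul_of_nonneg_right (hlδ i) (norm_nonneg _)).trans h1) hδ
  exact fun i => HasGeometricGrowth.of_le hA0.le fun a => key _ i a rfl

end Analytic

/-! ### Conjugations of attracting maps -/

section Attracting

variable {K : Type*} [NontriviallyNormedField K] [IsUltrametricDist K] [CompleteSpace K] {r : ℕ}

/-- A formal conjugation between attracting analytic maps is analytic. -/
theorem IsAnalytic.of_attracting {F G H : FormalMap K r} {l : Fin r → K}
    (hl0 : ∀ i, l i ≠ 0) (hl : ∀ i, ‖l i‖ < 1) (hF : F.HasDiagonalLinearPart l)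
    (hG : G.HasDiagonalLinearPart l) (hFa : F.IsAnalytic) (hGa : G.IsAnalytic)
    (h : H * F = G * H) : H.IsAnalytic := by
  classical
  rw [isAnalytic_iff] at *
  obtain ⟨C₁, hC₁, hGC⟩ := HasGeometricGrowth.exists_forall_le_pow hGa G.map_zero
  obtain ⟨C₂, hC₂, hFC⟩ := exists_norm_coeff_le_inv_mul_pow hF (fun i => (hl i).le) hFa
  obtain ⟨δ, hδ, hlδ⟩ := exists_pos_forall_le hl0
  obtain ⟨ρ, hρ, hCρ, hρδ⟩ := exists_pos_mul_sq_le (zero_lt_one.trans_le hC₁) hδ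
  obtain ⟨N₀, hN₀⟩ := exists_norm_eigenvalue_lt hl hδ
  -- Below degree `N₀` the divisor may vanish by resonance, so nothing can be solved for; these
  -- finitely many coefficients are bounded directly.
  have hlow : ∃ B : ℝ, ∀ i, ∀ a ∈ exponentsLT r N₀, ‖coeff a (H.comp i)‖ ≤ B := by
    refine ⟨∑ i, ∑ a ∈ exponentsLT r N₀, ‖coeff a (H.comp i)‖, fun i a ha => ?_⟩
    refine (Finset.single_le_sum (f := fun a => ‖coeff a (H.comp i)‖)
      (fun a _ => norm_nonneg _) ha).trans ?_
    exact Finset.single_le_sum (f := fun i => ∑ a ∈ exponentsLT r N₀, ‖coeff a (H.comp i)‖)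
      (fun i _ => Finset.sum_nonneg fun a _ => norm_nonneg _) (Finset.mem_univ i)
  obtain ⟨B, hB⟩ := hlow
  -- The three terms give C₂ ≤ A, C₂ / A ≤ δ for the sum coming from H ∘ F, and B ≤ ρ A for the low
  -- degrees.
  set A : ℝ := max (max C₂ (C₂ / δ)) (B / ρ)
  have hAC : C₂ ≤ A := (le_max_left _ _).trans (le_max_left _ _)
  have hA1 : 1 ≤ A := hC₂.trans hAC
  have hA0 : 0 < A := by positivity
  have hCA : C₂ / A ≤ δ := by
    rw [div_le_iff₀ hA0, ← div_le_iff₀' hδ]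
    exact (le_max_right _ _).trans (le_max_left _ _)
  have key : ∀ N, ∀ i (a : Fin r →₀ ℕ), a.degree = N → ‖coeff a (H.comp i)‖ ≤ ρ * A ^ a.degree := by
    intro N
    induction N using Nat.strong_induction_on with
    | _ N ih =>
      intro i a ha
      rcases Nat.eq_zero_or_pos a.degree with h0 | h0
      · rw [H.coeff_eq_zero_of_degree_eq_zero i h0, norm_zero]; positivity
      rcases Nat.lt_or_ge a.degree N₀ with hN | hN
      · calc ‖coeff a (H.comp i)‖ ≤ B := hB i a (mem_exponentsLT.mpr hN)
          _ = ρ * (B / ρ) := by field_simp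
          _ ≤ ρ * A := by gcongr; exact le_max_right _ _
          _ ≤ ρ * A ^ a.degree := by gcongr; exact le_self_pow₀ hA1 h0.ne'
      have he := congrArg (fun G : FormalMap K r => coeff a (G.comp i)) h
      simp only [mul_comp] at he
      rw [hG.coeff_subst_comp H.map_zero, hF.coeff_subst] at he
      have hb₁ := norm_sum_coeff_seriesMonomial_le (a := a) H.map_zero hA0.le (by positivity) hρ.le
        hCρ (fun s b hb => ih b.degree (by omega) s b rfl) (a.degree + 1) (hGC i)
      have hb₂ := norm_sum_coeff_le (a := a) (zero_lt_one.trans_le hC₂) hAC hρ.le (hFC C₂ le_rfl)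
        (fun b hb => ih b.degree (by omega) i b rfl)
      set S₁ := ∑ b ∈ exponentsLT r (a.degree + 1) with 2 ≤ b.degree,
        coeff b (G.comp i) * coeff a (seriesMonomial H.comp b)
      set S₂ := ∑ b ∈ exponentsLT r a.degree,
        coeff b (H.comp i) * coeff a (seriesMonomial F.comp b)
      -- In high degree |λ^a| < δ ≤ |λ_i|, and the strictly larger term determines an ultrametric
      -- norm.
      have hdiv : ‖eigenvalue l a - l i‖ = ‖l i‖ := by
        rw [norm_sub_rev]
        have := (hN₀ a hN).trans_le (hlδ i)
        rw [sub_eq_add_neg, IsUltrametricDist.norm_add_eq_max_of_norm_ne_norm, norm_neg,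
          max_eq_left this.le]
        rw [norm_neg]; exact this.ne'
      have h1 : ‖(eigenvalue l a - l i) * coeff a (H.comp i)‖ ≤ δ * ρ * A ^ a.degree := by
        have : (eigenvalue l a - l i) * coeff a (H.comp i) = S₁ - S₂ := by linear_combination he
        rw [this]
        refine (norm_sub_le_max_norm _ _).trans
          (max_le (hb₁.trans ?_) (hb₂.trans ?_)) <;> gcongr
      rw [norm_mul, hdiv, mul_assoc] at h1
      exact le_of_mul_le_mul_left
        ((mul_le_mul_of_nonneg_right (hlδ i) (norm_nonneg _)).trans h1) hδ
  exact fun i => HasGeometricGrowth.of_le hA0.le fun a => key _ i a rfl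

end Attracting

end FormalMap

namespace FormalMap

open MvPowerSeries

/-! ### Formal and analytic equivalence as relations, and passage to inverses -/

section Equivalence

variable {K : Type*} [Field K] {r : ℕ}

theorem conj_inverse_eq {M : Type*} [Monoid M] {f f' g g' h h' : M} (hf : f * f' = 1)
    (hg : g' * g = 1) (hh : h * h' = 1) (hh' : h' * h = 1) (he : h * f * h' = g) :
    h * f' * h' = g' := by
  have h1 : g * h = h * f := by rw [← he, mul_assoc (h * f), hh', mul_one]
  calc h * f' * h' = (g' * g) * h * f' * h' := by rw [hg, one_mul]
    _ = g' * (g * h) * f' * h' := by simp only [mul_assoc]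
    _ = g' * h * (f * f') * h' := by rw [h1]; simp only [mul_assoc]
    _ = g' := by rw [hf, mul_one, mul_assoc, hh, mul_one]

theorem FormallyEquivalent.inverse {F F' G G' : FormalMap K r} (hF : F * F' = 1)
    (hG : G' * G = 1) (h : F.FormallyEquivalent G) : F'.FormallyEquivalent G' := by
  obtain ⟨H, H', ⟨h1, h2⟩, h3⟩ := h
  exact ⟨H, H', ⟨h1, h2⟩, conj_inverse_eq hF hG h1 h2 h3⟩

theorem HasDiagonalLinearPart.ne_zero {H H' : FormalMap K r} {m : Fin r → K}
    (hH : H.HasDiagonalLinearPart m) (h : H' * H = 1) (i : Fin r) : m i ≠ 0 := by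
  intro hm
  have he := congrArg (fun G : FormalMap K r => coeff (Finsupp.single i 1) (G.comp i)) h
  simp only [mul_comp, one_comp] at he
  rw [hH.coeff_subst, eigenvalue_single, hm, zero_mul, zero_add, Finset.sum_eq_zero,
    coeff_single_X, if_pos rfl] at he
  · exact zero_ne_one he
  · intro b hb
    rw [mem_exponentsLT, Finsupp.degree_single] at hb
    rw [H'.coeff_eq_zero_of_degree_eq_zero i (by omega), zero_mul]

theorem FormallyEquivalent.symm {F G : FormalMap K r}
    (h : F.FormallyEquivalent G) : G.FormallyEquivalent F := by
  obtain ⟨H, H', ⟨h1, h2⟩, rfl⟩ := h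
  refine ⟨H', H, ⟨h2, h1⟩, ?_⟩
  change H' * (H * F * H') * H = F
  rw [← mul_assoc, ← mul_assoc, show H' * H = 1 from h2, one_mul, mul_assoc,
    show H' * H = 1 from h2, mul_one]

theorem FormallyEquivalent.trans {E F G : FormalMap K r}
    (h : E.FormallyEquivalent F) (h' : F.FormallyEquivalent G) : E.FormallyEquivalent G := by
  obtain ⟨H, H', ⟨h1, h2⟩, rfl⟩ := h
  obtain ⟨J, J', ⟨h3, h4⟩, rfl⟩ := h'
  refine ⟨J * H, H' * J', ⟨?_, ?_⟩, ?_⟩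
  · change J * H * (H' * J') = 1
    rw [mul_assoc, ← mul_assoc H, show H * H' = 1 from h1, one_mul]; exact h3
  · change H' * J' * (J * H) = 1
    rw [mul_assoc, ← mul_assoc J', show J' * J = 1 from h4, one_mul]; exact h2
  · change J * H * E * (H' * J') = J * (H * E * H') * J'
    simp only [mul_assoc]

theorem HasDiagonalLinearPart.coeff_of_degree_eq_one {F : FormalMap K r} {l : Fin r → K}
    (hF : F.HasDiagonalLinearPart l) (i : Fin r) {a : Fin r →₀ ℕ} (ha : a.degree = 1) :
    coeff a (F.comp i) = l i * coeff a (X i : MvPowerSeries (Fin r) K) := by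
  obtain ⟨j, rfl⟩ := exists_eq_single_of_degree_eq_one ha
  rw [hF, coeff_single_X]
  split_ifs <;> simp

/-- When `H` is tangent to the identity, the terms of top degree |b| = |a| contribute just the
coefficient of `f` at a. This isolates the unknown coefficient of the normal form in N ∘ H. -/
theorem HasDiagonalLinearPart.sum_eq_coeff_add {H : FormalMap K r}
    (hH : H.HasDiagonalLinearPart 1) (f : MvPowerSeries (Fin r) K) {a : Fin r →₀ ℕ}
    (ha : 2 ≤ a.degree) :
    ∑ b ∈ exponentsLT r (a.degree + 1) with 2 ≤ b.degree,
        coeff b f * coeff a (seriesMonomial H.comp b) =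
      coeff a f + ∑ b ∈ exponentsLT r a.degree with 2 ≤ b.degree,
        coeff b f * coeff a (seriesMonomial H.comp b) := by
  classical
  have hsub : {b ∈ exponentsLT r a.degree | 2 ≤ b.degree} ⊆
      {b ∈ exponentsLT r (a.degree + 1) | 2 ≤ b.degree} := fun b hb => by
    simp only [Finset.mem_filter, mem_exponentsLT] at hb ⊢; omega
  rw [← Finset.sum_sdiff hsub, Finset.sum_eq_single a]
  · rw [hH.coeff_seriesMonomial le_rfl, if_pos rfl]
    simp [eigenvalue]
  · intro b hb hba
    simp only [Finset.mem_sdiff, Finset.mem_filter, mem_exponentsLT] at hb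
    rw [hH.coeff_seriesMonomial (by omega), if_neg hba.symm, mul_zero]
  · intro h
    exact (h (by simp [ha])).elim

end Equivalence

section AnalyticEquivalence

variable {K : Type*} [NormedField K] {r : ℕ}

theorem AnalyticallyEquivalent.formallyEquivalent {F G : FormalMap K r}
    (h : F.AnalyticallyEquivalent G) : F.FormallyEquivalent G := by
  obtain ⟨H, H', -, -, h⟩ := h
  exact ⟨H, H', h⟩

theorem AnalyticallyEquivalent.inverse {F F' G G' : FormalMap K r} (hF : F * F' = 1)
    (hG : G' * G = 1) (h : F.AnalyticallyEquivalent G) : F'.AnalyticallyEquivalent G' := by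
  obtain ⟨H, H', ha, ha', ⟨h1, h2⟩, h3⟩ := h
  exact ⟨H, H', ha, ha', ⟨h1, h2⟩, conj_inverse_eq hF hG h1 h2 h3⟩

theorem AnalyticallyEquivalent.symm {F G : FormalMap K r}
    (h : F.AnalyticallyEquivalent G) : G.AnalyticallyEquivalent F := by
  obtain ⟨H, H', ha, ha', ⟨h1, h2⟩, rfl⟩ := h
  refine ⟨H', H, ha', ha, ⟨h2, h1⟩, ?_⟩
  change H' * (H * F * H') * H = F
  rw [← mul_assoc, ← mul_assoc, show H' * H = 1 from h2, one_mul, mul_assoc,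
    show H' * H = 1 from h2, mul_one]

end AnalyticEquivalence

section Ultrametric

variable {K : Type*} [NontriviallyNormedField K] [IsUltrametricDist K] [CompleteSpace K] {r : ℕ}

theorem AnalyticallyEquivalent.trans {E F G : FormalMap K r}
    (h : E.AnalyticallyEquivalent F) (h' : F.AnalyticallyEquivalent G) :
    E.AnalyticallyEquivalent G := by
  obtain ⟨H, H', ha, ha', ⟨h1, h2⟩, rfl⟩ := h
  obtain ⟨J, J', hb, hb', ⟨h3, h4⟩, rfl⟩ := h'
  refine ⟨J * H, H' * J', hb.mul ha, ha'.mul hb', ⟨?_, ?_⟩, ?_⟩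
  · change J * H * (H' * J') = 1
    rw [mul_assoc, ← mul_assoc H, show H * H' = 1 from h1, one_mul]; exact h3
  · change H' * J' * (J * H) = 1
    rw [mul_assoc, ← mul_assoc J', show J' * J = 1 from h4, one_mul]; exact h2
  · change J * H * E * (H' * J') = J * (H * E * H') * J'
    simp only [mul_assoc]

/-- An analytic semiconjugacy with invertible diagonal linear part is an analytic equivalence. -/
theorem AnalyticallyEquivalent.of_mul_eq_mul {F G H : FormalMap K r} {m : Fin r → K}
    (hm : ∀ i, m i ≠ 0) (hH : H.HasDiagonalLinearPart m) (ha : H.IsAnalytic)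
    (h : H * F = G * H) : F.AnalyticallyEquivalent G := by
  obtain ⟨H', h1, h2, -⟩ := exists_inverse hm hH
  refine ⟨H, H', ha, ha.of_mul_eq_one hm hH h1, ⟨h1, h2⟩, ?_⟩
  change H * F * H' = G
  rw [h, mul_assoc, h1, mul_one]

theorem FormallyEquivalent.analyticallyEquivalent_of_attracting {F G : FormalMap K r}
    {l : Fin r → K} (hl0 : ∀ i, l i ≠ 0) (hl : ∀ i, ‖l i‖ < 1) (hinj : Function.Injective l)
    (hF : F.HasDiagonalLinearPart l) (hG : G.HasDiagonalLinearPart l) (hFa : F.IsAnalytic)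
    (hGa : G.IsAnalytic) (h : F.FormallyEquivalent G) : F.AnalyticallyEquivalent G := by
  obtain ⟨H, H', ⟨h1, h2⟩, rfl⟩ := h
  have he : H * F = (H.circ F).circ H' * H := by
    change H * F = H * F * H' * H
    rw [mul_assoc (H * F), show H' * H = 1 from h2, mul_one]
  obtain ⟨m, hm⟩ := exists_hasDiagonalLinearPart hinj hF hG he
  exact .of_mul_eq_mul (hm.ne_zero h2) hm (.of_attracting hl0 hl hF hG hFa hGa he) he

/-- Formal and analytic equivalence may be compared on the inverse maps. -/
theorem FormallyEquivalent.analyticallyEquivalent_of_inverse {F G : FormalMap K r}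
    {l : Fin r → K} (hl0 : ∀ i, l i ≠ 0)
    (hF : F.HasDiagonalLinearPart l) (hG : G.HasDiagonalLinearPart l) (hFa : F.IsAnalytic)
    (hGa : G.IsAnalytic) (h : F.FormallyEquivalent G)
    (hinv : ∀ F' G' : FormalMap K r, F'.HasDiagonalLinearPart l⁻¹ → G'.HasDiagonalLinearPart l⁻¹ →
      F'.IsAnalytic → G'.IsAnalytic → F'.FormallyEquivalent G' → F'.AnalyticallyEquivalent G') :
    F.AnalyticallyEquivalent G := by
  obtain ⟨F', hF1, hF2, hF'⟩ := exists_inverse hl0 hF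
  obtain ⟨G', hG1, hG2, hG'⟩ := exists_inverse hl0 hG
  exact (hinv F' G' hF' hG' (hFa.of_mul_eq_one hl0 hF hF1) (hGa.of_mul_eq_one hl0 hG hG1)
    (h.inverse hF1 hG2)).inverse hF2 hG1

end Ultrametric

/-! ### Convergent Poincaré–Dulac normalisation -/

section NormalForm

variable {K : Type*} [NontriviallyNormedField K] [IsUltrametricDist K] [CompleteSpace K] {r : ℕ}

/-- Poincaré–Dulac normal form: if the non-resonant divisors are bounded below, an analytic map is
analytically conjugate to one that contains resonant monomials only. -/
theorem exists_normalForm {F : FormalMap K r} {l : Fin r → K} (hF : F.HasDiagonalLinearPart l)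
    (hl : ∀ i, ‖l i‖ ≤ 1) (hFa : F.IsAnalytic) (R : Fin r → (Fin r →₀ ℕ) → Prop)
    {δ : ℝ} (hδ : 0 < δ) (hδ1 : δ ≤ 1)
    (hnon : ∀ i a, ¬ R i a → δ ≤ ‖eigenvalue l a - l i‖) :
    ∃ H N : FormalMap K r, H.HasDiagonalLinearPart 1 ∧ N.HasDiagonalLinearPart l ∧
      H.IsAnalytic ∧ N.IsAnalytic ∧ H * F = N * H ∧
      ∀ i a, 2 ≤ a.degree → ¬ R i a → coeff a (N.comp i) = 0 := by
  classical
  -- One family `z` encodes both unknowns: from degree two on, `z (i, a)` is the coefficient of `N`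
  -- where `R` holds and that of `H` elsewhere, the other coefficient being 0.
  let HH : (Fin r × (Fin r →₀ ℕ) → K) → FormalMap K r := fun z => ofCoeffs fun p =>
    if p.2.degree = 1 then coeff p.2 (X p.1 : MvPowerSeries (Fin r) K) else
      if R p.1 p.2 then 0 else z p
  let NN : (Fin r × (Fin r →₀ ℕ) → K) → FormalMap K r := fun z => ofCoeffs fun p =>
    if p.2.degree = 1 then l p.1 * coeff p.2 (X p.1 : MvPowerSeries (Fin r) K) else
      if R p.1 p.2 then z p else 0
  have hHH : ∀ z i a, 2 ≤ a.degree → coeff a ((HH z).comp i) = if R i a then 0 else z (i, a) := by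
    intro z i a ha
    rw [coeff_ofCoeffs, if_neg (by omega), if_neg (show ¬ a.degree = 1 by omega)]
  have hNN : ∀ z i a, 2 ≤ a.degree → coeff a ((NN z).comp i) = if R i a then z (i, a) else 0 := by
    intro z i a ha
    rw [coeff_ofCoeffs, if_neg (by omega), if_neg (show ¬ a.degree = 1 by omega)]
  have hHl : ∀ z, (HH z).HasDiagonalLinearPart 1 := by
    intro z i j
    rw [coeff_ofCoeffs, if_neg (by simp), if_pos (by simp), coeff_single_X]; rfl
  have hNl : ∀ z, (NN z).HasDiagonalLinearPart l := by
    intro z i j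
    rw [coeff_ofCoeffs, if_neg (by simp), if_pos (by simp), coeff_single_X]
    simp
  let SN : (Fin r × (Fin r →₀ ℕ) → K) → Fin r × (Fin r →₀ ℕ) → K := fun z p =>
    ∑ b ∈ exponentsLT r p.2.degree with 2 ≤ b.degree,
      coeff b ((NN z).comp p.1) * coeff p.2 (seriesMonomial (HH z).comp b)
  let SF : (Fin r × (Fin r →₀ ℕ) → K) → Fin r × (Fin r →₀ ℕ) → K := fun z p =>
    ∑ b ∈ exponentsLT r p.2.degree, coeff b ((HH z).comp p.1) * coeff p.2 (seriesMonomial F.comp b)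
  -- At (i, a) the conjugation equation is λ^a H + SF = λ_i H + N + SN, with `SF` and `SN` of lower
  -- order. Solving it with H = 0 or with N = 0 gives the two branches.
  obtain ⟨z, hz⟩ := exists_fixedPoint_of_local (fun p : Fin r × (Fin r →₀ ℕ) => p.2.degree)
    (fun z p => if R p.1 p.2 then SF z p - SN z p else
      (SN z p - SF z p) / (eigenvalue l p.2 - l p.1)) (by
    intro z z' p hp
    have h1 : ∀ s b, b.degree < p.2.degree →
        coeff b ((HH z).comp s) = coeff b ((HH z').comp s) := by
      intro s b hb
      simp only [HH, coeff_ofCoeffs, hp (s, b) hb]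
    have h2 : ∀ s b, b.degree < p.2.degree →
        coeff b ((NN z).comp s) = coeff b ((NN z').comp s) := by
      intro s b hb
      simp only [NN, coeff_ofCoeffs, hp (s, b) hb]
    have h3 : SF z p = SF z' p := Finset.sum_congr rfl fun b hb => by
      rw [h1 _ _ (mem_exponentsLT.mp hb)]
    have h4 : SN z p = SN z' p := by
      simp only [SN]
      rw [sum_coeff_seriesMonomial_congr (HH z).map_zero (HH z').map_zero h1]
      refine Finset.sum_congr rfl fun b hb => ?_
      rw [Finset.mem_filter, mem_exponentsLT] at hb
      rw [h2 _ _ hb.1]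
    simp only [h3, h4])
  have hz' := fun i a => congrFun hz (i, a)
  simp only at hz'
  refine ⟨HH z, NN z, hHl z, hNl z, ?_⟩
  have hmul : HH z * F = NN z * HH z := by
    ext i a
    rw [mul_comp, mul_comp, hF.coeff_subst, (hNl z).coeff_subst_comp (HH z).map_zero]
    rcases Nat.lt_or_ge a.degree 2 with ha | ha
    · rw [Finset.sum_eq_zero, Finset.sum_eq_zero]
      · rcases Nat.eq_zero_or_pos a.degree with h0 | h0
        · rw [coeff_eq_zero_of_degree_eq_zero _ _ h0, mul_zero, mul_zero]
        · obtain ⟨j, rfl⟩ := exists_eq_single_of_degree_eq_one (show a.degree = 1 by omega)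
          rw [hHl z i j, eigenvalue_single]
          split_ifs with hij
          · rw [hij]
          · simp
      · intro b hb
        rw [Finset.mem_filter, mem_exponentsLT] at hb
        omega
      · intro b hb
        rw [mem_exponentsLT] at hb
        rw [coeff_eq_zero_of_degree_eq_zero _ _ (by omega), zero_mul]
    · rw [(hHl z).sum_eq_coeff_add _ ha]
      change _ + SF z (i, a) = _ + (_ + SN z (i, a))
      rw [hHH z i a ha, hNN z i a ha, ← hz' i a]
      split_ifs with hR
      · ring
      · have : eigenvalue l a - l i ≠ 0 :=
          norm_pos_iff.mp (hδ.trans_le (hnon i a hR))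
        field_simp
        ring
  obtain ⟨C, hC, hFC⟩ := exists_norm_coeff_le_inv_mul_pow hF hl (isAnalytic_iff.mp hFa)
  -- With C / A = δ, the gain in `norm_sum_coeff_le` exactly pays for the division by a divisor of
  -- norm at least `δ`.
  set A : ℝ := C / δ
  have hC0 : 0 < C := by positivity
  have hCA : C ≤ A := by rw [le_div_iff₀ hδ]; exact mul_le_of_le_one_right hC0.le hδ1
  have hA0 : 0 < A := hC0.trans_le hCA
  have hCAδ : C / A = δ := by simp only [A]; field_simp
  have hX : ∀ i (a : Fin r →₀ ℕ), a.degree = 1 →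
      ‖coeff a (X i : MvPowerSeries (Fin r) K)‖ ≤ A⁻¹ * A ^ a.degree := by
    intro i a ha
    rw [ha, pow_one, inv_mul_cancel₀ hA0.ne', coeff_X]
    split_ifs <;> simp
  -- The extra factor `δ` in the bound for `N` is needed so that `SN`, like `SF`, can be divided by
  -- the divisor. The scale A⁻¹ fits the identity in degree one, where the bound is 1.
  have key : ∀ n, ∀ i (a : Fin r →₀ ℕ), a.degree = n →
      ‖coeff a ((HH z).comp i)‖ ≤ A⁻¹ * A ^ a.degree ∧
      (2 ≤ a.degree → ‖coeff a ((NN z).comp i)‖ ≤ δ * A⁻¹ * A ^ a.degree) := by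
    intro n
    induction n using Nat.strong_induction_on with
    | _ n ih =>
      intro i a ha
      rcases Nat.lt_or_ge a.degree 2 with h2 | h2
      · refine ⟨?_, fun h => by omega⟩
        rcases Nat.eq_zero_or_pos a.degree with h0 | h0
        · rw [coeff_eq_zero_of_degree_eq_zero _ _ h0, norm_zero]; positivity
        · have h1 : a.degree = 1 := by omega
          rw [(hHl z).coeff_of_degree_eq_one i h1, Pi.one_apply, one_mul]
          exact hX i a h1
      have hH : ∀ s (b : Fin r →₀ ℕ), b.degree < a.degree →
          ‖coeff b ((HH z).comp s)‖ ≤ A⁻¹ * A ^ b.degree :=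
        fun s b hb => (ih b.degree (by omega) s b rfl).1
      have hSF : ‖SF z (i, a)‖ ≤ δ * A⁻¹ * A ^ a.degree := by
        rw [← hCAδ]
        exact norm_sum_coeff_le hC0 hCA (by positivity) (hFC C le_rfl) fun b hb => hH i b hb
      have hSN : ‖SN z (i, a)‖ ≤ δ * A⁻¹ * A ^ a.degree := by
        refine IsUltrametricDist.norm_sum_le_of_forall_le_of_nonneg (by positivity) fun b hb => ?_
        rw [Finset.mem_filter, mem_exponentsLT] at hb
        have h1 := norm_coeff_seriesMonomial_le_of_lt hA0.le (by positivity) (HH z).map_zero hH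
          hb.2 le_rfl
        have h3 := (ih b.degree (by have := hb.1; simp only at this; omega) i b rfl).2 hb.2
        rw [norm_mul]
        calc _ ≤ (δ * A⁻¹ * A ^ b.degree) * (A⁻¹ ^ b.degree * A ^ a.degree) := by gcongr
          _ = _ := by rw [inv_pow]; field_simp
      rw [hHH z i a h2, hNN z i a h2, ← hz' i a]
      split_ifs with hR
      · refine ⟨by rw [norm_zero]; positivity, fun _ => ?_⟩
        exact (norm_sub_le_max_norm _ _).trans (max_le hSF hSN)
      · refine ⟨?_, fun _ => by rw [norm_zero]; positivity⟩
        rw [norm_div, div_le_iff₀ (hδ.trans_le (hnon i a hR))]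
        refine (norm_sub_le_max_norm _ _).trans ((max_le hSN hSF).trans ?_)
        calc δ * A⁻¹ * A ^ a.degree = A⁻¹ * A ^ a.degree * δ := by ring
          _ ≤ _ := by gcongr; exact hnon i a hR
  refine ⟨isAnalytic_iff.mpr fun i => .of_le hA0.le fun a => (key _ i a rfl).1,
    isAnalytic_iff.mpr fun i => .of_le (M := A⁻¹) hA0.le fun a => ?_, hmul, fun i a ha hR => ?_⟩
  · rcases Nat.lt_or_ge a.degree 2 with h2 | h2
    · rcases Nat.eq_zero_or_pos a.degree with h0 | h0
      · rw [coeff_eq_zero_of_degree_eq_zero _ _ h0, norm_zero]; positivity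
      · have h1 : a.degree = 1 := by omega
        rw [(hNl z).coeff_of_degree_eq_one i h1, norm_mul]
        exact (mul_le_of_le_one_left (norm_nonneg _) (hl i)).trans (hX i a h1)
    · refine ((key _ i a rfl).2 h2).trans ?_
      gcongr
      exact mul_le_of_le_one_left (by positivity) hδ1
  · rw [hNN z i a ha, if_neg hR]

end NormalForm

end FormalMap

/-! ### The weight A^n / |n!| and the growth of inverse factorials -/

section FactorialWeight

open Nat

variable {K : Type*} [NormedField K]

/-- The weight `A ^ n / |n!|`. -/
noncomputable def factorialWeight (K : Type*) [NormedField K] (A : ℝ) (n : ℕ) : ℝ :=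
  A ^ n * ‖(n ! : K)‖⁻¹

theorem factorialWeight_nonneg {A : ℝ} (hA : 0 ≤ A) (n : ℕ) : 0 ≤ factorialWeight K A n := by
  unfold factorialWeight; positivity

@[simp] theorem factorialWeight_zero (A : ℝ) : factorialWeight K A 0 = 1 := by
  simp [factorialWeight]

theorem norm_factorial_pos [CharZero K] (n : ℕ) : 0 < ‖(n ! : K)‖ :=
  norm_pos_iff.mpr (by exact_mod_cast Nat.factorial_ne_zero n)

/-- This is the purpose of the weight: division by n + 1 in a recursion is paid for by one factor
`A`. -/
theorem norm_natCast_mul_factorialWeight [CharZero K] (A : ℝ) (n : ℕ) :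
    ‖((n + 1 : ℕ) : K)‖ * factorialWeight K A (n + 1) = A * factorialWeight K A n := by
  have h : 0 < ‖((n + 1 : ℕ) : K)‖ := norm_pos_iff.mpr (by exact_mod_cast n.succ_ne_zero)
  unfold factorialWeight
  rw [Nat.factorial_succ, Nat.cast_mul, norm_mul, mul_inv, pow_succ]
  field_simp

variable [IsUltrametricDist K]

/-- By Bézout, if p and n both had norm less than one, so would 1. -/
theorem norm_natCast_eq_one_of_coprime {p n : ℕ} (hp : ‖(p : K)‖ < 1) (h : Nat.Coprime p n) :
    ‖(n : K)‖ = 1 := by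
  refine le_antisymm (IsUltrametricDist.norm_natCast_le_one K n) ?_
  by_contra! hn
  have hb := Nat.isCoprime_iff_coprime.mpr h
  obtain ⟨a, b, hab⟩ := hb
  have h1 : (a : K) * p + b * n = 1 := by exact_mod_cast congrArg (Int.cast : ℤ → K) hab
  have h2 : ‖(a : K) * p + b * n‖ < 1 := by
    refine (IsUltrametricDist.norm_add_le_max _ _).trans_lt (max_lt ?_ ?_) <;> rw [norm_mul]
    · exact (mul_le_of_le_one_left (norm_nonneg _)
        (IsUltrametricDist.norm_intCast_le_one K a)).trans_lt hp
    · exact (mul_le_of_le_one_left (norm_nonneg _)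
        (IsUltrametricDist.norm_intCast_le_one K b)).trans_lt hn
  rw [h1, norm_one] at h2
  exact lt_irrefl _ h2

/-- In a non-archimedean field of characteristic zero, `1 / n!` grows at most geometrically. -/
theorem exists_inv_norm_factorial_le [CharZero K] :
    ∃ E : ℝ, 1 ≤ E ∧ ∀ n : ℕ, ‖(n ! : K)‖⁻¹ ≤ E ^ n := by
  -- If some prime p has norm less than one, then |n!| is |p| to the exponent of p in n!; otherwise
  -- all nonzero integers have norm one.
  by_cases h : ∃ p : ℕ, p.Prime ∧ ‖(p : K)‖ < 1
  · obtain ⟨p, hp, hp1⟩ := h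
    have hp0 : 0 < ‖(p : K)‖ := norm_pos_iff.mpr (by exact_mod_cast hp.ne_zero)
    have hinv : 1 ≤ ‖(p : K)‖⁻¹ := (one_le_inv₀ hp0).mpr hp1.le
    refine ⟨‖(p : K)‖⁻¹, hinv, fun n => ?_⟩
    obtain ⟨m, hm, hnm⟩ := Nat.exists_eq_pow_mul_and_not_dvd (Nat.factorial_ne_zero n) p
      hp.ne_one
    obtain ⟨hpm, hnm⟩ := hnm
    -- Legendre's formula: p - 1 times the exponent of p in n! is n minus a digit sum.
    have hle : m ≤ n := by
      have : Fact p.Prime := ⟨hp⟩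
      have h1 : m ≤ padicValNat p n ! :=
        (padicValNat_dvd_iff_le (Nat.factorial_ne_zero n)).mp ⟨_, hnm⟩
      have h2 := sub_one_mul_padicValNat_factorial (p := p) n
      have h3 : 1 ≤ p - 1 := by have := hp.two_le; omega
      have : padicValNat p n ! ≤ (p - 1) * padicValNat p n ! := Nat.le_mul_of_pos_left _ h3
      omega
    rw [hnm, Nat.cast_mul, norm_mul, Nat.cast_pow, norm_pow,
      norm_natCast_eq_one_of_coprime hp1 ((Nat.Prime.coprime_iff_not_dvd hp).mpr hpm), mul_one,
      ← inv_pow]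
    exact pow_le_pow_right₀ hinv hle
  · push Not at h
    have h1 : ∀ n : ℕ, n ≠ 0 → 1 ≤ ‖(n : K)‖ := by
      intro n
      induction n using Nat.recOnMul with
      | zero => intro h0; exact (h0 rfl).elim
      | one => simp
      | prime p hp => intro _; exact h p hp
      | mul a b ha hb =>
        intro hab
        rw [Nat.cast_mul, norm_mul]
        exact one_le_mul_of_one_le_of_one_le (ha (left_ne_zero_of_mul hab))
          (hb (right_ne_zero_of_mul hab))
    exact ⟨1, le_rfl, fun n => by
      rw [one_pow]; exact inv_le_one_of_one_le₀ (h1 _ (Nat.factorial_ne_zero n))⟩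

variable [CharZero K]

theorem pow_le_factorialWeight {A : ℝ} (hA : 0 ≤ A) (n : ℕ) : A ^ n ≤ factorialWeight K A n :=
  le_mul_of_one_le_right (by positivity)
    ((one_le_inv₀ (norm_factorial_pos n)).mpr (IsUltrametricDist.norm_natCast_le_one K _))

/-- Binomial coefficients are integers, hence of norm at most one. This makes the weight compatible
with products of series. -/
theorem factorialWeight_mul_le {A : ℝ} (hA : 0 ≤ A) (m n : ℕ) :
    factorialWeight K A m * factorialWeight K A n ≤ factorialWeight K A (m + n) := by
  have h : ‖((m + n)! : K)‖ ≤ ‖(m ! : K)‖ * ‖(n ! : K)‖ := by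
    rw [← Nat.add_choose_mul_factorial_mul_factorial m n]
    push_cast
    rw [norm_mul, norm_mul, mul_assoc]
    exact mul_le_of_le_one_left (by positivity) (IsUltrametricDist.norm_natCast_le_one K _)
  unfold factorialWeight
  calc _ = A ^ (m + n) * (‖(m ! : K)‖ * ‖(n ! : K)‖)⁻¹ := by rw [pow_add, mul_inv]; ring
    _ ≤ _ := by
        gcongr
        exact norm_factorial_pos _

theorem pow_mul_factorialWeight_le {A D : ℝ} (hD : 0 ≤ D) (hDA : D ≤ A) (m n : ℕ) :
    D ^ m * factorialWeight K A n ≤ factorialWeight K A (n + m) := by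
  have hA := hD.trans hDA
  refine le_trans ?_ (factorialWeight_mul_le hA n m)
  rw [mul_comm]
  gcongr
  · exact factorialWeight_nonneg hA n
  · exact (pow_le_pow_left₀ hD hDA m).trans (pow_le_factorialWeight hA m)

/-- Lower order terms of a recursion with geometrically bounded coefficients. -/
theorem norm_sum_mul_le_factorialWeight {A B D : ℝ} (hB : 0 ≤ B) (hD : 1 ≤ D) (hDA : D ≤ A)
    {a c : ℕ → K} {d k i : ℕ} (ha : ∀ j < d + (i + 1), ‖a j‖ ≤ B * factorialWeight K A (j - d))
    (hc : ∀ j < d + (i + 1), ‖c j‖ ≤ D ^ (d + (i + 1) + k - j)) :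
    ‖∑ j ∈ Finset.range (d + (i + 1)), a j * c j‖ ≤
      B * D ^ (k + d + 1) * factorialWeight K A i := by
  have hA : 0 ≤ A := by linarith
  have hw := factorialWeight_nonneg (K := K) hA
  refine IsUltrametricDist.norm_sum_le_of_forall_le_of_nonneg
    (mul_nonneg (by positivity) (hw i)) fun j hj => ?_
  rw [Finset.mem_range] at hj
  -- Truncated subtraction is intended: for j ≤ d the weight is 1 and e = i, so the first
  -- coefficients only need the bound `B`.
  obtain ⟨e, he⟩ : ∃ e, (j - d) + e = i := ⟨i - (j - d), by omega⟩
  rw [norm_mul]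
  calc _ ≤ (B * factorialWeight K A (j - d)) * D ^ (d + (i + 1) + k - j) := by
        gcongr
        · exact mul_nonneg hB (hw _)
        · exact ha j hj
        · exact hc j hj
    _ ≤ (B * factorialWeight K A (j - d)) * D ^ (k + d + 1 + e) := by
        gcongr
        · exact mul_nonneg hB (hw _)
        · omega
    _ = B * D ^ (k + d + 1) * (D ^ e * factorialWeight K A (j - d)) := by rw [pow_add]; ring
    _ ≤ B * D ^ (k + d + 1) * factorialWeight K A i := by
        refine mul_le_mul_of_nonneg_left ?_ (by positivity)
        rw [← he]
        exact pow_mul_factorialWeight_le (by positivity) hDA _ _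

end FactorialWeight

/-! ### One-variable series: substitution, Taylor remainder, weighted bounds -/

section OneVariable

open PowerSeries

variable {K : Type*} [NormedField K]

theorem hasGeometricGrowth_powerSeries_iff {f : PowerSeries K} :
    HasGeometricGrowth (σ := Unit) f ↔ ∃ C : ℝ, 1 ≤ C ∧ ∀ n, ‖coeff n f‖ ≤ C ^ (n + 1) := by
  refine exists_congr fun C => and_congr_right fun _ => ⟨fun h n => ?_, fun h a => ?_⟩
  · simpa using h (Finsupp.single () n)
  · obtain ⟨n, rfl⟩ : ∃ n, a = Finsupp.single () n := ⟨a (), by ext; simp⟩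
    simpa using h n

theorem hasGeometricGrowth_powerSeries_of_le {f : PowerSeries K} {M C : ℝ} (hC : 0 ≤ C)
    (h : ∀ n, ‖coeff n f‖ ≤ M * C ^ n) : HasGeometricGrowth (σ := Unit) f := by
  refine HasGeometricGrowth.of_le (M := M) hC fun a => ?_
  obtain ⟨n, rfl⟩ : ∃ n, a = Finsupp.single () n := ⟨a (), by ext; simp⟩
  simpa using h n

theorem exists_norm_coeff_le_pow {f : PowerSeries K} (hf : HasGeometricGrowth (σ := Unit) f)
    (h0 : ‖constantCoeff f‖ ≤ 1) : ∃ C : ℝ, 1 ≤ C ∧ ∀ n, ‖coeff n f‖ ≤ C ^ n := by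
  obtain ⟨C, hC, h⟩ := hasGeometricGrowth_powerSeries_iff.mp hf
  refine ⟨C ^ 2, one_le_pow₀ hC, fun n => ?_⟩
  rcases Nat.eq_zero_or_pos n with rfl | hn
  · simpa using h0
  · rw [← pow_mul]
    exact (h n).trans (pow_le_pow_right₀ hC (by omega))

theorem coeff_subst_eq_sum_range {K : Type*} [Field K] {h : PowerSeries K}
    (h0 : constantCoeff h = 0) (g : PowerSeries K) {n N : ℕ} (hN : n < N) :
    coeff n (g.subst h) = ∑ r ∈ Finset.range N, coeff r g * coeff n (h ^ r) := by
  rw [coeff_subst' (HasSubst.of_constantCoeff_zero' h0)]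
  refine finsum_eq_sum_of_support_subset _ fun r hr => ?_
  rw [Finset.mem_coe, Finset.mem_range]
  by_contra hrn
  refine hr ?_
  have : coeff n (h ^ r) = 0 :=
    X_pow_dvd_iff.mp (pow_dvd_pow_of_dvd (X_dvd_iff.mpr h0) r) n (by omega)
  simp only [this, smul_zero]

theorem coeff_pow_self {K : Type*} [Field K] {h : PowerSeries K} (h0 : constantCoeff h = 0)
    (n : ℕ) : coeff n (h ^ n) = coeff 1 h ^ n := by
  obtain ⟨p, rfl⟩ := X_dvd_iff.mpr h0
  have h1 := coeff_X_pow_mul (p ^ n) n 0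
  have h2 := coeff_succ_X_mul 0 p
  rw [zero_add] at h1 h2
  rw [mul_pow, h1, h2]
  simp

theorem coeff_subst_of_lt {K : Type*} [Field K] {g h : PowerSeries K} (h0 : constantCoeff h = 0)
    {n : ℕ} (hg : ∀ r < n, coeff r g = 0) :
    coeff n (g.subst h) = coeff n g * coeff 1 h ^ n := by
  rw [coeff_subst_eq_sum_range h0 g n.lt_succ_self, Finset.sum_range_succ, Finset.sum_eq_zero,
    zero_add, coeff_pow_self h0]
  intro r hr
  rw [hg r (Finset.mem_range.mp hr), zero_mul]

/-- The second order Taylor remainder: `(P + s) ^ r = P ^ r + r P ^ (r - 1) s + s ^ 2 R_r`. -/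
noncomputable def powTaylorRemainder {R : Type*} [CommRing R] (P s : R) : ℕ → R
  | 0 => 0
  | r + 1 => powTaylorRemainder P s r * (P + s) + r * P ^ (r - 1)

theorem add_pow_eq_taylor {R : Type*} [CommRing R] (P s : R) (r : ℕ) :
    (P + s) ^ r = P ^ r + r * P ^ (r - 1) * s + s ^ 2 * powTaylorRemainder P s r := by
  induction r with
  | zero => simp [powTaylorRemainder]
  | succ r ih =>
    rw [pow_succ, ih, powTaylorRemainder]
    -- The exponent r - 1 truncates at r = 0, where its factor r vanishes anyway.
    rcases r with _ | r
    · simp [powTaylorRemainder]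
    · simp only [Nat.add_sub_cancel]
      push_cast
      ring

variable [IsUltrametricDist K]

/-- The weight is left general to cover both A^n and A^n / |n!|. The restriction to n < N allows its
use within an induction on the degree. -/
theorem norm_coeff_mul_le_weight {w : ℕ → ℝ} (hw0 : ∀ n, 0 ≤ w n)
    (hw : ∀ m n, w m * w n ≤ w (m + n)) {f g : PowerSeries K} {N : ℕ} {M M' : ℝ}
    (hM : 0 ≤ M) (hM' : 0 ≤ M') (hf : ∀ n < N, ‖coeff n f‖ ≤ M * w n)
    (hg : ∀ n < N, ‖coeff n g‖ ≤ M' * w n) :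
    ∀ n < N, ‖coeff n (f * g)‖ ≤ M * M' * w n := by
  intro n hn
  rw [coeff_mul]
  refine IsUltrametricDist.norm_sum_le_of_forall_le_of_nonneg
    (mul_nonneg (by positivity) (hw0 n)) fun p hp => ?_
  have hp := Finset.HasAntidiagonal.mem_antidiagonal.mp hp
  rw [norm_mul]
  calc ‖coeff p.1 f‖ * ‖coeff p.2 g‖ ≤ (M * w p.1) * (M' * w p.2) := by
        gcongr
        · exact mul_nonneg hM (hw0 _)
        · exact hf _ (by omega)
        · exact hg _ (by omega)
    _ = M * M' * (w p.1 * w p.2) := by ring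
    _ ≤ _ := by
        gcongr
        rw [← hp]
        exact hw _ _

theorem norm_coeff_pow_le_weight {w : ℕ → ℝ} (hw0 : ∀ n, 0 ≤ w n) (hw1 : 1 ≤ w 0)
    (hw : ∀ m n, w m * w n ≤ w (m + n)) {f : PowerSeries K} {N : ℕ} {M : ℝ}
    (hM : 0 ≤ M) (hf : ∀ n < N, ‖coeff n f‖ ≤ M * w n) (r : ℕ) :
    ∀ n < N, ‖coeff n (f ^ r)‖ ≤ M ^ r * w n := by
  induction r with
  | zero =>
    intro n hn
    rw [pow_zero, pow_zero, one_mul, coeff_one]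
    split_ifs with h
    · rw [h, norm_one]; exact hw1
    · rw [norm_zero]; exact hw0 n
  | succ r ih =>
    rw [pow_succ, pow_succ]
    exact norm_coeff_mul_le_weight hw0 hw (by positivity) hM ih hf

/-- The remainder is homogeneous of degree r - 2 in P and s with integer coefficients, so it carries
r - 2 factors C⁻¹. -/
theorem norm_coeff_powTaylorRemainder_le {w : ℕ → ℝ} (hw0 : ∀ n, 0 ≤ w n) (hw1 : 1 ≤ w 0)
    (hw : ∀ m n, w m * w n ≤ w (m + n)) {P s : PowerSeries K} {N : ℕ} {C : ℝ} (hC : 0 < C)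
    (hP : ∀ n < N, ‖coeff n P‖ ≤ C⁻¹ * w n) (hs : ∀ n < N, ‖coeff n s‖ ≤ C⁻¹ * w n) (r : ℕ) :
    ∀ n < N, ‖coeff n (powTaylorRemainder P s r)‖ ≤ C ^ 2 * C⁻¹ ^ r * w n := by
  induction r with
  | zero =>
    intro n hn
    simpa [powTaylorRemainder] using mul_nonneg (sq_nonneg C) (hw0 n)
  | succ r ih =>
    intro n hn
    rw [powTaylorRemainder, map_add]
    refine (IsUltrametricDist.norm_add_le_max _ _).trans (max_le ?_ ?_)
    · rw [pow_succ C⁻¹, ← mul_assoc]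
      refine norm_coeff_mul_le_weight hw0 hw (by positivity) (by positivity) ih (fun n hn => ?_)
        n hn
      rw [map_add]
      exact (IsUltrametricDist.norm_add_le_max _ _).trans (max_le (hP n hn) (hs n hn))
    · rcases r with _ | r
      · simpa using mul_nonneg (by positivity : (0 : ℝ) ≤ C ^ 2 * C⁻¹) (hw0 n)
      · have h1 := norm_coeff_pow_le_weight hw0 hw1 hw (by positivity) hP r n hn
        have h2 : C ^ 2 * C⁻¹ ^ (r + 1 + 1) = C⁻¹ ^ r := by
          rw [pow_succ C⁻¹, pow_succ C⁻¹, inv_pow]; field_simp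
        rw [h2, Nat.add_sub_cancel, ← nsmul_eq_mul, map_nsmul, nsmul_eq_mul, norm_mul]
        exact (mul_le_of_le_one_left (norm_nonneg _)
          (IsUltrametricDist.norm_natCast_le_one K _)).trans h1

end OneVariable

/-! ### Linearisation of g ∘ h in the tail of h -/

section OneVariableRecursion

open PowerSeries

theorem HasGeometricGrowth.powerSeries_subst {τ K : Type*} [NormedField K] [IsUltrametricDist K]
    {h : MvPowerSeries τ K} (hh : HasGeometricGrowth h) (h0 : MvPowerSeries.constantCoeff h = 0)
    {g : PowerSeries K} (hg : HasGeometricGrowth (σ := Unit) g) :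
    HasGeometricGrowth (g.subst h) :=
  HasGeometricGrowth.subst (fun _ => hh) (fun _ => h0) hg

variable {K : Type*} [NormedField K] [IsUltrametricDist K] [CharZero K]

/-- The coefficient `2k + 2 + i` of `g (P + x ^ (k + 1) q)` for `g` of order at least `k + 1`: its
dependence on `q` is through the coefficient `i + 1` linearly, up to a controlled error. -/
theorem exists_norm_coeff_subst_sub_le {g P : PowerSeries K}
    (hg : HasGeometricGrowth (σ := Unit) g) (hP : HasGeometricGrowth (σ := Unit) P)
    (hP0 : constantCoeff P = 0) {k : ℕ} (hgk : ∀ r ≤ k, coeff r g = 0) :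
    ∃ M A₀ : ℝ, 0 ≤ M ∧ 1 ≤ A₀ ∧ ∀ A, A₀ ≤ A → ∀ (q : PowerSeries K) (i : ℕ),
      (∀ j < i + 1, ‖coeff j q‖ ≤ factorialWeight K A j) →
      ‖coeff (2 * k + 2 + i) (g.subst (P + X ^ (k + 1) * q)) -
        ((k + 1 : ℕ) : K) * coeff (k + 1) g * coeff 1 P ^ k * coeff (i + 1) q‖ ≤
          M * factorialWeight K A i := by
  obtain ⟨C, hC, hgC⟩ := hasGeometricGrowth_powerSeries_iff.mp hg
  obtain ⟨D, hD, hPD⟩ := exists_norm_coeff_le_pow hP (by rw [hP0]; simp)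
  obtain ⟨C₁, hC₁, hgP⟩ := hasGeometricGrowth_powerSeries_iff.mp
    (HasGeometricGrowth.powerSeries_subst (h := P) hP hP0 hg)
  have hC0 : 0 < C := by positivity
  have hE : 1 ≤ C * D := one_le_mul_of_one_le_of_one_le hC hD
  -- The factor C⁻¹ in each power of P offsets the growth C^(r+1) of the coefficients of `g`.
  have hPE : ∀ n, ‖coeff n P‖ ≤ C⁻¹ * (C * D) ^ n := by
    intro n
    rcases n with _ | n
    · rw [coeff_zero_eq_constantCoeff_apply, hP0, norm_zero]; positivity
    · refine (hPD _).trans ?_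
      rw [mul_pow, pow_succ C]
      have : C⁻¹ * (C ^ n * C * D ^ (n + 1)) = C ^ n * D ^ (n + 1) := by field_simp
      rw [this]
      exact le_mul_of_one_le_left (by positivity) (one_le_pow₀ hC)
  have hPr : ∀ r n, n < r → coeff n (P ^ r) = 0 := fun r n hn =>
    X_pow_dvd_iff.mp (pow_dvd_pow_of_dvd (X_dvd_iff.mpr hP0) r) n hn
  have hCE : 1 ≤ C ^ 2 * (C * D) := one_le_mul_of_one_le_of_one_le (one_le_pow₀ hC) hE
  refine ⟨max (C₁ ^ (2 * k + 3)) (max ((C ^ 2 * (C * D)) ^ (k + 1)) (C ^ 3)),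
    max C₁ (C ^ 2 * (C * D)), by positivity, hC₁.trans (le_max_left _ _), ?_⟩
  intro A hA q i hq
  have hA₁ : C₁ ≤ A := (le_max_left _ _).trans hA
  have hA₂ : C ^ 2 * (C * D) ≤ A := (le_max_right _ _).trans hA
  have hA₃ : C * D ≤ A := (le_mul_of_one_le_left (by positivity) (one_le_pow₀ hC)).trans hA₂
  have hA₄ : C ≤ A := (le_mul_of_one_le_right hC0.le hD).trans hA₃
  have hA1 : 1 ≤ A := hC.trans hA₄
  have hA0 : 0 ≤ A := by linarith
  have hw0 := factorialWeight_nonneg (K := K) hA0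
  have hw := factorialWeight_mul_le (K := K) hA0
  set n := 2 * k + 2 + i
  -- `V` is g'(P) and `U` the quadratic Taylor remainder, both cut off at r = n, since higher powers
  -- do not reach the coefficient n.
  set V : PowerSeries K := ∑ r ∈ Finset.range (n + 1),
    PowerSeries.C (coeff r g) * (r * P ^ (r - 1)) with hV
  set U : PowerSeries K := ∑ r ∈ Finset.range (n + 1),
    PowerSeries.C (coeff r g) * powTaylorRemainder P (X ^ (k + 1) * q) r with hU
  have hh0 : constantCoeff (P + X ^ (k + 1) * q) = 0 := by simp [hP0]
  -- The quadratic term carries x^(2k+2), so at n = 2k + 2 + i it involves `q` only up to index i.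
  -- This is why the tail is split off at degree k + 1.
  have hexp : coeff n (g.subst (P + X ^ (k + 1) * q)) =
      coeff n (g.subst P) + coeff (i + 1 + k) (q * V) + coeff i (q ^ 2 * U) := by
    have h1 : ∑ r ∈ Finset.range (n + 1), PowerSeries.C (coeff r g) * (P + X ^ (k + 1) * q) ^ r =
        ∑ r ∈ Finset.range (n + 1), PowerSeries.C (coeff r g) * P ^ r + X ^ (k + 1) * (q * V) +
          X ^ (2 * k + 2) * (q ^ 2 * U) := by
      rw [hV, hU, Finset.mul_sum, Finset.mul_sum, Finset.mul_sum, Finset.mul_sum,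
        ← Finset.sum_add_distrib, ← Finset.sum_add_distrib]
      refine Finset.sum_congr rfl fun r _ => ?_
      rw [add_pow_eq_taylor]
      ring
    have h2 := congrArg (coeff n) h1
    rw [map_add, map_add, map_sum, map_sum] at h2
    simp only [coeff_C_mul] at h2
    rw [coeff_subst_eq_sum_range hh0 g n.lt_succ_self,
      coeff_subst_eq_sum_range hP0 g n.lt_succ_self, h2]
    have e1 : n = (i + 1 + k) + (k + 1) := by omega
    have e2 : n = i + (2 * k + 2) := by omega
    have e3 : coeff n (X ^ (k + 1) * (q * V)) = coeff (i + 1 + k) (q * V) := by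
      rw [e1, coeff_X_pow_mul]
    have e4 : coeff n (X ^ (2 * k + 2) * (q ^ 2 * U)) = coeff i (q ^ 2 * U) := by
      rw [e2, coeff_X_pow_mul]
    rw [e3, e4]
  have hVc : ∀ a, coeff a V = ∑ r ∈ Finset.range (n + 1),
      coeff r g * (r * coeff a (P ^ (r - 1))) := by
    intro a
    rw [hV, map_sum]
    refine Finset.sum_congr rfl fun r _ => ?_
    rw [coeff_C_mul, ← nsmul_eq_mul, map_nsmul, nsmul_eq_mul]
  have hV0 : ∀ a < k, coeff a V = 0 := by
    intro a ha
    rw [hVc]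
    refine Finset.sum_eq_zero fun r _ => ?_
    rcases Nat.lt_or_ge k r with h | h
    · rw [hPr _ _ (by omega), mul_zero, mul_zero]
    · rw [hgk r h, zero_mul]
  -- As `V` has order at least k, the highest coefficient of `q` in the linear term is that of index
  -- i + 1, multiplied by this value.
  have hVk : coeff k V = ((k + 1 : ℕ) : K) * coeff (k + 1) g * coeff 1 P ^ k := by
    rw [hVc, Finset.sum_eq_single (k + 1)]
    · rw [Nat.add_sub_cancel, coeff_pow_self hP0]; ring
    · intro r _ hr
      rcases Nat.lt_or_ge k r with h | h
      · rw [hPr _ _ (by omega), mul_zero, mul_zero]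
      · rw [hgk r h, zero_mul]
    · intro h
      exact (h (Finset.mem_range.mpr (by omega))).elim
  have hVb : ∀ a, ‖coeff a V‖ ≤ C ^ 2 * (C * D) ^ a := by
    intro a
    rw [hVc]
    refine IsUltrametricDist.norm_sum_le_of_forall_le_of_nonneg (by positivity) fun r _ => ?_
    rcases r with _ | r
    · simp only [Nat.cast_zero, zero_mul, mul_zero, norm_zero]; positivity
    · have h1 := norm_coeff_pow_le_weight (w := fun n => (C * D) ^ n) (fun n => by positivity)
        (by simp) (fun m n => (pow_add _ m n).ge) (N := a + 1) (by positivity)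
        (fun n _ => hPE n) r a (by omega)
      rw [Nat.add_sub_cancel, norm_mul, norm_mul]
      calc _ ≤ C ^ (r + 1 + 1) * (1 * (C⁻¹ ^ r * (C * D) ^ a)) := by
            gcongr
            · exact hgC _
            · exact IsUltrametricDist.norm_natCast_le_one K _
        _ = _ := by rw [inv_pow, pow_succ, pow_succ]; field_simp
  have hsum : coeff (i + 1 + k) (q * V) =
      (∑ j ∈ Finset.range (0 + (i + 1)), coeff j q * coeff (i + 1 + k - j) V) +
        coeff (i + 1) q * coeff k V := by
    rw [coeff_mul, Finset.Nat.sum_antidiagonal_eq_sum_range_succ_mk]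
    rw [← Finset.sum_subset (s₁ := Finset.range (i + 1 + 1))
      (Finset.range_subset_range.mpr (by omega)), Finset.sum_range_succ, zero_add]
    · simp
    · intro j hj hj'
      rw [Finset.mem_range] at hj hj'
      simp only
      rw [hV0 _ (by omega), mul_zero]
  have hb₁ : ‖coeff n (g.subst P)‖ ≤ C₁ ^ (2 * k + 3) * factorialWeight K A i := by
    refine (hgP n).trans ?_
    rw [show n + 1 = (2 * k + 3) + i by omega, pow_add]
    gcongr
    exact (pow_le_pow_left₀ (by positivity) hA₁ i).trans (pow_le_factorialWeight hA0 i)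
  have hb₂ : ‖∑ j ∈ Finset.range (0 + (i + 1)), coeff j q * coeff (i + 1 + k - j) V‖ ≤
      (C ^ 2 * (C * D)) ^ (k + 1) * factorialWeight K A i := by
    have := norm_sum_mul_le_factorialWeight (K := K) (A := A) (B := 1) (D := C ^ 2 * (C * D))
      zero_le_one hCE hA₂ (a := fun j => coeff j q) (c := fun j => coeff (i + 1 + k - j) V)
      (d := 0) (k := k) (i := i) (fun j hj => by
        rw [one_mul]; exact hq j (by omega)) (fun j hj => by
        refine (hVb _).trans ?_
        rw [mul_pow (C ^ 2), show 0 + (i + 1) + k - j = i + 1 + k - j by omega]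
        gcongr
        exact le_self_pow₀ (one_le_pow₀ hC) (by omega))
    simpa using this
  have hb₃ : ‖coeff i (q ^ 2 * U)‖ ≤ C ^ 3 * factorialWeight K A i := by
    have hPw : ∀ m < i + 1, ‖coeff m P‖ ≤ C⁻¹ * factorialWeight K A m := fun m _ => by
      refine (hPE m).trans ?_
      gcongr
      exact (pow_le_pow_left₀ (by positivity) hA₃ m).trans (pow_le_factorialWeight hA0 m)
    have hsw : ∀ m < i + 1, ‖coeff m (X ^ (k + 1) * q)‖ ≤ C⁻¹ * factorialWeight K A m := by
      intro m hm
      rw [coeff_X_pow_mul']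
      split_ifs with h
      · refine (hq _ (by omega)).trans ?_
        rw [← div_eq_inv_mul, le_div_iff₀' hC0]
        have h1 := pow_mul_factorialWeight_le (K := K) hA0 le_rfl (k + 1) (m - (k + 1))
        rw [Nat.sub_add_cancel h] at h1
        refine le_trans ?_ h1
        refine mul_le_mul_of_nonneg_right ?_ (hw0 _)
        exact hA₄.trans (le_self_pow₀ hA1 (by omega))
      · rw [norm_zero]; exact mul_nonneg (by positivity) (hw0 _)
    rw [hU, Finset.mul_sum, map_sum]
    refine IsUltrametricDist.norm_sum_le_of_forall_le_of_nonneg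
      (mul_nonneg (by positivity) (hw0 _)) fun r _ => ?_
    rw [mul_left_comm, coeff_C_mul, norm_mul]
    have h1 := norm_coeff_mul_le_weight hw0 hw (by norm_num) (by positivity)
      (norm_coeff_pow_le_weight hw0 (by simp) hw zero_le_one
        (fun m hm => by rw [one_mul]; exact hq m hm) 2)
      (norm_coeff_powTaylorRemainder_le hw0 (by simp) hw hC0 hPw hsw r) i (by omega)
    calc _ ≤ C ^ (r + 1) * (1 ^ 2 * (C ^ 2 * C⁻¹ ^ r) * factorialWeight K A i) := by
          gcongr
          exact hgC r
      _ = _ := by rw [inv_pow, pow_succ]; field_simp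
  rw [hexp, hsum, hVk]
  have hring : ∀ a b c d e : K, a + (b + c * d) + e - d * c = a + b + e := fun a b c d e => by ring
  rw [hring]
  refine (IsUltrametricDist.norm_add_le_max _ _).trans (max_le
    ((IsUltrametricDist.norm_add_le_max _ _).trans (max_le (hb₁.trans ?_) (hb₂.trans ?_)))
    (hb₃.trans ?_)) <;> refine mul_le_mul_of_nonneg_right ?_ (hw0 i)
  · exact le_max_left _ _
  · exact (le_max_left _ _).trans (le_max_right _ _)
  · exact (le_max_right _ _).trans (le_max_right _ _)

end OneVariableRecursion

/-! ### Algebra of composition with a germ tangent to the identity -/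

section Tangent

open PowerSeries

variable {K : Type*} [Field K]

/-- The power equals x^j (1 + j x^k ψ + O(x^(2k))), and 2k ≥ k + 1, so up to relative degree k only
the first two terms are seen. -/
theorem coeff_pow_tangent {ψ : PowerSeries K} {k j e : ℕ} (he : e ≤ k) (hk : 1 ≤ k) :
    coeff (j + e) ((X + X ^ (k + 1) * ψ) ^ j) =
      (if e = 0 then 1 else 0) + if e = k then j * constantCoeff ψ else 0 := by
  have h1 : (X + X ^ (k + 1) * ψ) ^ j = X ^ j * (1 + X ^ k * ψ) ^ j := by
    rw [← mul_pow]; ring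
  have h2 : (X ^ k * ψ) ^ 2 * powTaylorRemainder 1 (X ^ k * ψ) j =
      X ^ (k + 1) * (X ^ (k - 1) * ψ ^ 2 * powTaylorRemainder 1 (X ^ k * ψ) j) := by
    obtain ⟨c, rfl⟩ := Nat.exists_eq_add_of_le hk
    rw [Nat.add_sub_cancel_left]
    ring
  have h3 : coeff e ((X ^ k * ψ) ^ 2 * powTaylorRemainder 1 (X ^ k * ψ) j) = 0 := by
    rw [h2, coeff_X_pow_mul', if_neg (by omega)]
  rw [h1, add_comm j e, coeff_X_pow_mul, add_pow_eq_taylor, one_pow, one_pow, map_add, map_add, h3,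
    add_zero, mul_one, coeff_one, ← nsmul_eq_mul, map_nsmul, nsmul_eq_mul, coeff_X_pow_mul']
  congr 1
  by_cases h : e = k
  · simp [h]
  · rw [if_neg h, if_neg (by omega), mul_zero]

theorem constantCoeff_tangent (ψ : PowerSeries K) (k : ℕ) :
    constantCoeff (X + X ^ (k + 1) * ψ) = 0 := by simp

/-- Coefficients of `a ∘ f` for `f = x + ψ₀ x ^ (k + 1) + ⋯`. -/
theorem coeff_subst_tangent (a ψ : PowerSeries K) {k : ℕ} (hk : 1 ≤ k) (m : ℕ) :
    coeff (m + k) (a.subst (X + X ^ (k + 1) * ψ)) =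
      coeff (m + k) a + m * constantCoeff ψ * coeff m a +
        ∑ j ∈ Finset.range m, coeff j a * coeff (m + k) ((X + X ^ (k + 1) * ψ) ^ j) := by
  rw [coeff_subst_eq_sum_range (constantCoeff_tangent ψ k) a (Nat.lt_add_one (m + k)),
    add_assoc m k 1, Finset.sum_range_add, add_comm (∑ j ∈ Finset.range m, _)]
  congr 1
  -- Among the exponents m, …, m + k only the two ends contribute.
  rw [Finset.sum_range_succ, Finset.sum_eq_single 0]
  · have h0 := coeff_pow_tangent (ψ := ψ) (j := m) (e := k) le_rfl hk
    have h1 := coeff_pow_tangent (ψ := ψ) (j := m + k) (e := 0) (Nat.zero_le k) hk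
    rw [add_zero] at h1
    rw [add_zero, h0, h1, if_neg (by omega), if_pos rfl, if_pos rfl, if_neg (by omega)]
    ring
  · intro x hx hx0
    rw [Finset.mem_range] at hx
    rw [show m + k = m + x + (k - x) by omega, coeff_pow_tangent (by omega) hk, if_neg (by omega),
      if_neg (by omega), add_zero, mul_zero]
  · intro h
    exact (h (Finset.mem_range.mpr (by omega))).elim

theorem coeff_subst_tangent_of_le (a ψ : PowerSeries K) {k : ℕ} (hk : 1 ≤ k) {n : ℕ}
    (hn : n ≤ k) : coeff n (a.subst (X + X ^ (k + 1) * ψ)) = coeff n a := by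
  rcases hn.eq_or_lt with rfl | hn
  · simpa using coeff_subst_tangent a ψ hk 0
  · rw [coeff_subst_eq_sum_range (constantCoeff_tangent ψ k) a n.lt_succ_self,
      Finset.sum_eq_single n]
    · have h1 := coeff_pow_tangent (ψ := ψ) (j := n) (e := 0) (Nat.zero_le k) hk
      rw [add_zero] at h1
      rw [h1, if_pos rfl, if_neg (by omega), add_zero, mul_one]
    · intro j hj hjn
      rw [Finset.mem_range] at hj
      have h1 := coeff_pow_tangent (ψ := ψ) (j := j) (e := n - j) (k := k) (by omega) hk
      rw [show j + (n - j) = n by omega] at h1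
      rw [h1, if_neg (by omega), if_neg (by omega), add_zero, mul_zero]
    · intro h
      exact (h (Finset.mem_range.mpr (by omega))).elim

theorem eq_zero_of_subst_eq_zero {g h : PowerSeries K} (h0 : constantCoeff h = 0)
    (h1 : coeff 1 h ≠ 0) (hg : g.subst h = 0) : g = 0 := by
  ext n
  induction n using Nat.strong_induction_on with
  | _ n ih =>
    have := coeff_subst_of_lt h0 ih
    rw [hg, map_zero] at this
    rw [map_zero]
    exact (mul_eq_zero.mp this.symm).resolve_right (pow_ne_zero _ h1)

/-- A nonzero power series is a power of `x` times a unit. -/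
theorem exists_eq_X_pow_mul {f : PowerSeries K} (hf : f ≠ 0) :
    ∃ (n : ℕ) (ψ : PowerSeries K), f = X ^ n * ψ ∧ constantCoeff ψ ≠ 0 := by
  classical
  have hex : ∃ n, coeff n f ≠ 0 := by
    by_contra! h
    exact hf (ext h)
  obtain ⟨n, hn, hmin⟩ : ∃ n, coeff n f ≠ 0 ∧ ∀ m < n, coeff m f = 0 :=
    ⟨Nat.find hex, Nat.find_spec hex, fun m hm => not_not.mp (Nat.find_min hex hm)⟩
  obtain ⟨ψ, hψ⟩ := X_pow_dvd_iff.mpr hmin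
  refine ⟨n, ψ, hψ, fun h => hn ?_⟩
  rw [hψ]
  simpa [coeff_X_pow_mul'] using h

/-- The part of `h` of degree at most `d`. -/
noncomputable def seriesHead (d : ℕ) (h : PowerSeries K) : PowerSeries K :=
  (trunc (d + 1) h : Polynomial K)

/-- The part of `h` of degree greater than `d`, divided by `x ^ d`. -/
noncomputable def seriesTail (d : ℕ) (h : PowerSeries K) : PowerSeries K :=
  PowerSeries.mk fun i => if i = 0 then 0 else coeff (d + i) h

theorem coeff_seriesHead (d n : ℕ) (h : PowerSeries K) :
    coeff n (seriesHead d h) = if n < d + 1 then coeff n h else 0 := by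
  rw [seriesHead, Polynomial.coeff_coe, coeff_trunc]

theorem coeff_seriesTail_succ (d i : ℕ) (h : PowerSeries K) :
    coeff (i + 1) (seriesTail d h) = coeff (d + (i + 1)) h := by
  rw [seriesTail, coeff_mk, if_neg (by omega)]

theorem seriesHead_add_seriesTail (d : ℕ) (h : PowerSeries K) :
    seriesHead d h + X ^ d * seriesTail d h = h := by
  ext n
  rw [map_add, coeff_seriesHead, coeff_X_pow_mul']
  rcases Nat.lt_or_ge d n with hn | hn
  · obtain ⟨i, rfl⟩ := Nat.exists_eq_add_of_lt hn
    rw [if_neg (by omega), if_pos (by omega), zero_add, show d + i + 1 - d = i + 1 by omega,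
      coeff_seriesTail_succ, add_assoc]
  · rw [if_pos (by omega)]
    split_ifs with hd
    · rw [show n - d = 0 by omega, seriesTail, coeff_mk, if_pos rfl, add_zero]
    · rw [add_zero]

end Tangent

/-! ### Convergence of the one-variable conjugation equations -/

section TangentGrowth

open PowerSeries

variable {K : Type*} [NormedField K]

theorem hasGeometricGrowth_seriesHead (d : ℕ) (h : PowerSeries K) :
    HasGeometricGrowth (σ := Unit) (seriesHead d h) := by
  refine hasGeometricGrowth_powerSeries_of_le (M := ∑ j ∈ Finset.range (d + 1), ‖coeff j h‖)
    zero_le_one fun n => ?_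
  rw [one_pow, mul_one, coeff_seriesHead]
  split_ifs with hn
  · exact Finset.single_le_sum (f := fun j => ‖coeff j h‖) (fun j _ => norm_nonneg _)
      (Finset.mem_range.mpr hn)
  · rw [norm_zero]; exact Finset.sum_nonneg fun j _ => norm_nonneg _

theorem hasGeometricGrowth_X : HasGeometricGrowth (σ := Unit) (X : PowerSeries K) :=
  hasGeometricGrowth_powerSeries_of_le (M := 1) zero_le_one fun n => by
    rw [coeff_X]; split_ifs <;> simp

theorem hasGeometricGrowth_C (c : K) : HasGeometricGrowth (σ := Unit) (C c : PowerSeries K) :=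
  hasGeometricGrowth_powerSeries_of_le (M := ‖c‖) zero_le_one fun n => by
    rw [coeff_C]; split_ifs <;> simp

theorem hasGeometricGrowth_one : HasGeometricGrowth (σ := Unit) (1 : PowerSeries K) := by
  simpa using hasGeometricGrowth_C (1 : K)

variable [IsUltrametricDist K]

theorem HasGeometricGrowth.powerSeries_inv {f : PowerSeries K}
    (hf : HasGeometricGrowth (σ := Unit) f) (h0 : constantCoeff f ≠ 0) :
    HasGeometricGrowth (σ := Unit) f⁻¹ := by
  obtain ⟨C, hC, hfC⟩ := hasGeometricGrowth_powerSeries_iff.mp hf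
  have hc : 0 < ‖constantCoeff f‖⁻¹ := inv_pos.mpr (norm_pos_iff.mpr h0)
  set c := ‖constantCoeff f‖⁻¹
  -- For m ≥ 1, the bound c C^(m+1) on a term of the recursion is at most E^m, as m + 1 ≤ 2m.
  set E := max 1 c * C ^ 2
  have hE : 0 < E := by positivity
  refine hasGeometricGrowth_powerSeries_of_le (M := c) (C := E) hE.le fun n => ?_
  induction n using Nat.strong_induction_on with
  | _ n ih =>
    rw [coeff_inv]
    split_ifs with hn
    · rw [hn, norm_inv, pow_zero, mul_one]
    · rw [norm_mul, norm_neg, norm_inv]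
      refine mul_le_mul_of_nonneg_left ?_ hc.le
      refine IsUltrametricDist.norm_sum_le_of_forall_le_of_nonneg (by positivity) fun x hx => ?_
      have hx := Finset.HasAntidiagonal.mem_antidiagonal.mp hx
      split_ifs with hxn
      · rw [norm_mul]
        calc _ ≤ C ^ (x.1 + 1) * (c * E ^ x.2) := by
              gcongr
              · exact hfC _
              · exact ih _ hxn
          _ ≤ E ^ x.1 * E ^ x.2 := by
              rw [← mul_assoc]
              gcongr
              rw [mul_pow, mul_comm, ← pow_mul]
              gcongr
              · exact (le_max_right _ _).trans (le_self_pow₀ (le_max_left _ _) (by omega))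
              · omega
          _ = _ := by rw [← pow_add, hx]
      · rw [norm_zero]; positivity

variable [CharZero K]

/-- Besides its two leading terms, the coefficient m + k of a ∘ f involves only a_j with j < m.
Their multipliers are coefficients of (1 + x^k ψ)^j, bounded uniformly in j because the base has
constant term 1. -/
theorem exists_norm_coeff_subst_tangent_sub_le {ψ : PowerSeries K} {k : ℕ} (hk : 1 ≤ k)
    (hf : HasGeometricGrowth (σ := Unit) (X + X ^ (k + 1) * ψ)) :
    ∃ D : ℝ, 1 ≤ D ∧ ∀ A, D ≤ A → ∀ (B : ℝ), 0 ≤ B → ∀ (d i : ℕ) (a : PowerSeries K),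
      (∀ j < d + (i + 1), ‖coeff j a‖ ≤ B * factorialWeight K A (j - d)) →
      ‖coeff (d + (i + 1) + k) (a.subst (X + X ^ (k + 1) * ψ)) - coeff (d + (i + 1) + k) a -
        ((d + (i + 1) : ℕ) : K) * constantCoeff ψ * coeff (d + (i + 1)) a‖ ≤
          B * D ^ (k + d + 1) * factorialWeight K A i := by
  have hφ : HasGeometricGrowth (σ := Unit) (1 + X ^ k * ψ) := by
    obtain ⟨C, hC, hfC⟩ := hasGeometricGrowth_powerSeries_iff.mp hf
    refine hasGeometricGrowth_powerSeries_of_le (M := C ^ 2) (C := C) (by positivity) fun n => ?_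
    have h1 : (X + X ^ (k + 1) * ψ) = X * (1 + X ^ k * ψ) := by ring
    rw [h1] at hfC
    have := hfC (n + 1)
    rw [coeff_succ_X_mul] at this
    exact this.trans_eq (by ring)
  obtain ⟨D, hD, hφD⟩ := exists_norm_coeff_le_pow hφ (by
    rcases k with _ | k
    · omega
    · simp)
  refine ⟨D, hD, fun A hA B hB d i a ha => ?_⟩
  rw [coeff_subst_tangent a ψ hk]
  have hring : ∀ x y z : K, x + y + z - x - y = z := fun x y z => by ring
  rw [hring]
  refine norm_sum_mul_le_factorialWeight hB hD hA ha fun j hj => ?_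
  have h1 : (X + X ^ (k + 1) * ψ) ^ j = X ^ j * (1 + X ^ k * ψ) ^ j := by
    rw [← mul_pow]; ring
  rw [h1, coeff_X_pow_mul', if_pos (by omega)]
  have := norm_coeff_pow_le_weight (w := fun n => D ^ n) (fun n => by positivity)
        (by simp) (fun m n => (pow_add _ m n).ge) (N := d + (i + 1) + k - j + 1) zero_le_one
        (fun n _ => by rw [one_mul]; exact hφD n) j _ (Nat.lt_succ_self _)
  simpa using this

/-- A series whose tail satisfies a Fuchsian recursion grows geometrically. -/
theorem hasGeometricGrowth_of_tail {h : PowerSeries K} {d : ℕ} {M A₀ : ℝ}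
    (hrec : ∀ A, A₀ ≤ A → ∀ i,
      (∀ j < i + 1, ‖coeff j (seriesTail d h)‖ ≤ factorialWeight K A j) →
      ‖((i + 1 : ℕ) : K)‖ * ‖coeff (i + 1) (seriesTail d h)‖ ≤ M * factorialWeight K A i) :
    HasGeometricGrowth (σ := Unit) h := by
  obtain ⟨E, hE, hfac⟩ := exists_inv_norm_factorial_le (K := K)
  set A := max (max A₀ M) 1
  have hA₀ : A₀ ≤ A := (le_max_left _ _).trans (le_max_left _ _)
  have hAM : M ≤ A := (le_max_right _ _).trans (le_max_left _ _)
  have hA1 : 1 ≤ A := le_max_right _ _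
  have hA0 : 0 ≤ A := by positivity
  have key : ∀ i, ‖coeff i (seriesTail d h)‖ ≤ factorialWeight K A i := by
    intro i
    induction i using Nat.strong_induction_on with
    | _ i ih =>
      rcases i with _ | i
      · rw [seriesTail, coeff_mk, if_pos rfl, norm_zero]; exact factorialWeight_nonneg hA0 _
      · have h1 := hrec A hA₀ i ih
        have h2 : M * factorialWeight K A i ≤ A * factorialWeight K A i :=
          mul_le_mul_of_nonneg_right hAM (factorialWeight_nonneg hA0 _)
        rw [← norm_natCast_mul_factorialWeight] at h2
        exact le_of_mul_le_mul_left (h1.trans h2)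
          (norm_pos_iff.mpr (by exact_mod_cast i.succ_ne_zero))
  have htail : HasGeometricGrowth (σ := Unit) (seriesTail d h) := by
    refine hasGeometricGrowth_powerSeries_of_le (M := 1) (C := A * E) (by positivity) fun n => ?_
    refine (key n).trans ?_
    rw [one_mul, mul_pow, factorialWeight]
    gcongr
    exact hfac n
  have hX : HasGeometricGrowth (σ := Unit) (X ^ d : PowerSeries K) :=
    hasGeometricGrowth_powerSeries_of_le (M := 1) zero_le_one fun n => by
      rw [coeff_X_pow]; split_ifs <;> simp
  rw [← seriesHead_add_seriesTail d h]
  exact (hasGeometricGrowth_seriesHead d h).add (HasGeometricGrowth.mul hX htail)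

/-- A formal conjugation between analytic germs tangent to, and different from, the identity is
analytic. -/
theorem hasGeometricGrowth_of_conj_tangent {ψ g h : PowerSeries K} {k : ℕ} (hk : 1 ≤ k)
    (hψ : constantCoeff ψ ≠ 0) (hf : HasGeometricGrowth (σ := Unit) (X + X ^ (k + 1) * ψ))
    (hg : HasGeometricGrowth (σ := Unit) g) (h0 : constantCoeff h = 0) (h1 : coeff 1 h ≠ 0)
    (hconj : h.subst (X + X ^ (k + 1) * ψ) = g.subst h) :
    HasGeometricGrowth (σ := Unit) h := by
  have hsub : (g - X).subst h = h.subst (X + X ^ (k + 1) * ψ) - h := by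
    have hs := HasSubst.of_constantCoeff_zero' h0
    rw [subst_sub hs, subst_X hs, hconj]
  -- Composition with f does not change coefficients up to degree k, so (g - x) ∘ h = h ∘ f - h
  -- starts in degree k + 1, and so does g - x.
  have hord : ∀ r ≤ k, coeff r (g - X) = 0 := by
    intro r
    induction r using Nat.strong_induction_on with
    | _ r ih =>
      intro hr
      have h2 := coeff_subst_of_lt h0 (g := g - X) fun s hs => ih s hs (by omega)
      rw [hsub, map_sub, coeff_subst_tangent_of_le h ψ hk hr, sub_self] at h2
      exact (mul_eq_zero.mp h2.symm).resolve_right (pow_ne_zero _ h1)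
  have hlead : coeff (k + 1) (g - X) * coeff 1 h ^ k = constantCoeff ψ := by
    have h2 := coeff_subst_of_lt h0 (g := g - X) (n := k + 1) fun s hs => hord s (by omega)
    have h3 := coeff_subst_tangent h ψ hk 1
    rw [Finset.sum_range_one, pow_zero, coeff_one, if_neg (by omega), mul_zero, add_zero,
      add_comm 1 k] at h3
    rw [hsub, map_sub, h3] at h2
    refine mul_right_cancel₀ h1 ?_
    rw [mul_assoc, ← pow_succ, ← h2]
    push_cast
    ring
  have hhead0 : constantCoeff (seriesHead (k + 1) h) = 0 := by
    rw [← coeff_zero_eq_constantCoeff_apply, coeff_seriesHead, if_pos (by omega),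
      coeff_zero_eq_constantCoeff_apply, h0]
  obtain ⟨M₁, A₁, hM₁, hA₁, hT⟩ := exists_norm_coeff_subst_sub_le (k := k)
    (hg.sub hasGeometricGrowth_X) (hasGeometricGrowth_seriesHead (k + 1) h) hhead0 hord
  obtain ⟨D, hD, hL⟩ := exists_norm_coeff_subst_tangent_sub_le hk hf
  -- The sum bounds the head of `h`, where the shifted weight is 1; the summand 1 lets the same `B`
  -- serve the tail.
  set B := 1 + ∑ j ∈ Finset.range (k + 2), ‖coeff j h‖ with hBdef
  have hB1 : 1 ≤ B := le_add_of_nonneg_right (Finset.sum_nonneg fun j _ => norm_nonneg _)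
  have hψ0 : 0 < ‖constantCoeff ψ‖ := norm_pos_iff.mpr hψ
  refine hasGeometricGrowth_of_tail (d := k + 1)
    (M := max M₁ (B * D ^ (k + (k + 1) + 1)) / ‖constantCoeff ψ‖) (A₀ := max A₁ D)
    fun A hA i hi => ?_
  have hA0 : 0 ≤ A := by linarith [(le_max_left A₁ D).trans hA]
  have hw0 := factorialWeight_nonneg (K := K) hA0
  have e₁ := hT A ((le_max_left _ _).trans hA) (seriesTail (k + 1) h) i hi
  have e₂ := hL A ((le_max_right _ _).trans hA) B (by linarith) (k + 1) i h (by
    intro j hj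
    rcases Nat.lt_or_ge j (k + 2) with hjk | hjk
    · rw [show j - (k + 1) = 0 by omega, factorialWeight_zero, mul_one]
      have := Finset.single_le_sum (f := fun j => ‖coeff j h‖) (fun j _ => norm_nonneg _)
        (Finset.mem_range.mpr hjk)
      linarith
    · obtain ⟨e, rfl⟩ : ∃ e, j = k + 1 + (e + 1) := ⟨j - (k + 2), by omega⟩
      rw [← coeff_seriesTail_succ, Nat.add_sub_cancel_left]
      exact (hi _ (by omega)).trans (le_mul_of_one_le_left (hw0 _) hB1))
  rw [seriesHead_add_seriesTail, hsub, map_sub, show 2 * k + 2 + i = k + 1 + (i + 1) + k by ring,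
    coeff_seriesHead, if_pos (by omega), mul_assoc ((k + 1 : ℕ) : K), hlead,
    coeff_seriesTail_succ] at e₁
  rw [div_mul_eq_mul_div, le_div_iff₀ hψ0, coeff_seriesTail_succ, ← norm_mul, ← norm_mul]
  set S := coeff (k + 1 + (i + 1) + k) (h.subst (X + X ^ (k + 1) * ψ)) -
    coeff (k + 1 + (i + 1) + k) h
  set q := coeff (k + 1 + (i + 1)) h
  -- The coefficient S is expanded in two ways: through h ∘ f - h, where q has factor (k+1+(i+1))
  -- ψ(0), and through (g - x) ∘ h, where by `hlead` it has factor (k+1) ψ(0). The difference leaves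
  -- the divisor (i+1) ψ(0).
  have : ((i + 1 : ℕ) : K) * q * constantCoeff ψ =
      (S - ((k + 1 : ℕ) : K) * constantCoeff ψ * q) -
        (S - ((k + 1 + (i + 1) : ℕ) : K) * constantCoeff ψ * q) := by
    push_cast; ring
  rw [this]
  refine (norm_sub_le_max_norm _ _).trans (max_le (e₁.trans ?_) (e₂.trans ?_)) <;>
    refine mul_le_mul_of_nonneg_right ?_ (hw0 i)
  · exact le_max_left _ _
  · exact le_max_right _ _

/-- A formal change of variable between nonconstant analytic functions is analytic. -/
theorem hasGeometricGrowth_of_subst {g h : PowerSeries K} (hg : HasGeometricGrowth (σ := Unit) g)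
    (hg' : g ≠ C (constantCoeff g)) (h0 : constantCoeff h = 0) (h1 : coeff 1 h ≠ 0)
    (hgh : HasGeometricGrowth (σ := Unit) (g.subst h)) : HasGeometricGrowth (σ := Unit) h := by
  have hs := HasSubst.of_constantCoeff_zero' h0
  obtain ⟨n, ψ, hn, hψ⟩ := exists_eq_X_pow_mul (sub_ne_zero.mpr hg')
  have hsubst : (g - C (constantCoeff g)).subst h = g.subst h - C (constantCoeff g) := by
    rw [subst_sub hs, subst_C]; rfl
  obtain ⟨k, rfl⟩ : ∃ k, n = k + 1 := by
    refine Nat.exists_eq_succ_of_ne_zero ?_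
    rintro rfl
    refine hψ ?_
    rw [pow_zero, one_mul] at hn
    rw [← hn]; simp
  have hord : ∀ r ≤ k, coeff r (g - C (constantCoeff g)) = 0 := fun r hr => by
    rw [hn, coeff_X_pow_mul', if_neg (by omega)]
  have hlead : coeff (k + 1) (g - C (constantCoeff g)) = constantCoeff ψ := by
    rw [hn, coeff_X_pow_mul', if_pos le_rfl, Nat.sub_self, coeff_zero_eq_constantCoeff_apply]
  have hhead0 : constantCoeff (seriesHead (k + 1) h) = 0 := by
    rw [← coeff_zero_eq_constantCoeff_apply, coeff_seriesHead, if_pos (by omega),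
      coeff_zero_eq_constantCoeff_apply, h0]
  obtain ⟨M₁, A₁, hM₁, hA₁, hT⟩ := exists_norm_coeff_subst_sub_le (k := k)
    (hg.sub (hasGeometricGrowth_C _)) (hasGeometricGrowth_seriesHead (k + 1) h) hhead0 hord
  obtain ⟨C₁, hC₁, hC⟩ := hasGeometricGrowth_powerSeries_iff.mp
    (hgh.sub (hasGeometricGrowth_C (constantCoeff g)))
  set c : K := ((k + 1 : ℕ) : K) * constantCoeff ψ * coeff 1 h ^ k
  have hc0 : 0 < ‖c‖ := norm_pos_iff.mpr (mul_ne_zero (mul_ne_zero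
    (by exact_mod_cast k.succ_ne_zero) hψ) (pow_ne_zero _ h1))
  refine hasGeometricGrowth_of_tail (d := k + 1)
    (M := max M₁ (C₁ ^ (2 * k + 3)) / ‖c‖) (A₀ := max A₁ C₁) fun A hA i hi => ?_
  have hA0 : 0 ≤ A := by linarith [(le_max_left A₁ C₁).trans hA]
  have hw0 := factorialWeight_nonneg (K := K) hA0
  have e₁ := hT A ((le_max_left _ _).trans hA) (seriesTail (k + 1) h) i hi
  rw [seriesHead_add_seriesTail, hsubst, coeff_seriesHead, if_pos (by omega), hlead] at e₁
  have e₂ : ‖coeff (2 * k + 2 + i) (g.subst h - C (constantCoeff g))‖ ≤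
      C₁ ^ (2 * k + 3) * factorialWeight K A i := by
    refine (hC _).trans ?_
    rw [show 2 * k + 2 + i + 1 = (2 * k + 3) + i by ring, pow_add]
    gcongr
    exact (pow_le_pow_left₀ (by positivity) ((le_max_right _ _).trans hA) i).trans
      (pow_le_factorialWeight hA0 i)
  -- The divisor `c` does not depend on i here; the factor |i+1| ≤ 1 is kept only to fit the form of
  -- `hasGeometricGrowth_of_tail`.
  refine (mul_le_of_le_one_left (norm_nonneg _)
    (IsUltrametricDist.norm_natCast_le_one K _)).trans ?_
  rw [div_mul_eq_mul_div, le_div_iff₀ hc0, ← norm_mul, mul_comm _ c]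
  set S := coeff (2 * k + 2 + i) (g.subst h - C (constantCoeff g))
  set q := coeff (i + 1) (seriesTail (k + 1) h)
  rw [show c * q = S - (S - c * q) by ring]
  refine (norm_sub_le_max_norm _ _).trans (max_le (e₂.trans ?_) (e₁.trans ?_)) <;>
    refine mul_le_mul_of_nonneg_right ?_ (hw0 i)
  · exact le_max_right _ _
  · exact le_max_left _ _

/-- Formal solutions of `u ∘ f = (1 + τ) u` are analytic for `f` tangent to, and different from, the
identity. -/
theorem hasGeometricGrowth_of_cocycle {ψ τ u : PowerSeries K} {k : ℕ} (hk : 1 ≤ k)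
    (hψ : constantCoeff ψ ≠ 0) (hf : HasGeometricGrowth (σ := Unit) (X + X ^ (k + 1) * ψ))
    (hτ : HasGeometricGrowth (σ := Unit) τ) (hu : constantCoeff u ≠ 0)
    (heq : u.subst (X + X ^ (k + 1) * ψ) = (1 + τ) * u) : HasGeometricGrowth (σ := Unit) u := by
  have hsub : u.subst (X + X ^ (k + 1) * ψ) - u = u * τ := by rw [heq]; ring
  -- The product u τ = u ∘ f - u has order at least k + 1, and u is a unit.
  have hτ0 : ∀ n ≤ k, coeff n τ = 0 := by
    have h1 : X ^ (k + 1) ∣ u * τ := by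
      rw [X_pow_dvd_iff]
      intro m hm
      rw [← hsub, map_sub, coeff_subst_tangent_of_le u ψ hk (by omega), sub_self]
    have h2 : τ = u⁻¹ * (u * τ) := by rw [← mul_assoc, PowerSeries.inv_mul_cancel u hu, one_mul]
    have h3 : X ^ (k + 1) ∣ τ := by rw [h2]; exact h1.mul_left _
    exact fun n hn => X_pow_dvd_iff.mp h3 n (by omega)
  obtain ⟨D, hD, hL⟩ := exists_norm_coeff_subst_tangent_sub_le hk hf
  obtain ⟨C₁, hC₁, hτC⟩ := exists_norm_coeff_le_pow hτ (by
    rw [← coeff_zero_eq_constantCoeff_apply, hτ0 0 (Nat.zero_le k)]; simp)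
  obtain ⟨E, hE, hfac⟩ := exists_inv_norm_factorial_le (K := K)
  set B := max 1 ‖constantCoeff u‖
  have hB0 : 0 ≤ B := by positivity
  have hψ0 : 0 < ‖constantCoeff ψ‖ := norm_pos_iff.mpr hψ
  set M := max (C₁ ^ (k + 1)) (D ^ (k + 1)) / ‖constantCoeff ψ‖
  set A := max (max C₁ D) M
  have hA₁ : C₁ ≤ A := (le_max_left _ _).trans (le_max_left _ _)
  have hA₂ : D ≤ A := (le_max_right _ _).trans (le_max_left _ _)
  have hAM : M ≤ A := le_max_right _ _
  have hA0 : 0 ≤ A := by linarith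
  have hw0 := factorialWeight_nonneg (K := K) hA0
  have key : ∀ i, ‖coeff i u‖ ≤ B * factorialWeight K A i := by
    intro i
    induction i using Nat.strong_induction_on with
    | _ i ih =>
      rcases i with _ | i
      · rw [factorialWeight_zero, mul_one, coeff_zero_eq_constantCoeff_apply]
        exact le_max_right _ _
      have ih' : ∀ j < 0 + (i + 1), ‖coeff j u‖ ≤ B * factorialWeight K A (j - 0) := by
        intro j hj
        exact ih j (by omega)
      have e₁ := hL A hA₂ B hB0 0 i u ih'
      have e₂ := norm_sum_mul_le_factorialWeight hB0 hC₁ hA₁ ih'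
        (c := fun j => coeff (0 + (i + 1) + k - j) τ) (k := k) fun j _ => hτC _
      -- By the order of τ, only u_j with j ≤ i enter, so (i+1) ψ(0) u_{i+1} is determined by lower
      -- coefficients.
      have hsum : coeff (0 + (i + 1) + k) (u * τ) = ∑ j ∈ Finset.range (0 + (i + 1)),
          coeff j u * coeff (0 + (i + 1) + k - j) τ := by
        rw [coeff_mul, Finset.Nat.sum_antidiagonal_eq_sum_range_succ_mk,
          ← Finset.sum_subset (s₁ := Finset.range (0 + (i + 1)))
          (Finset.range_subset_range.mpr (by omega))]
        intro j hj hj'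
        rw [Finset.mem_range] at hj hj'
        simp only
        rw [hτ0 _ (by omega), mul_zero]
      rw [← hsum, ← hsub, map_sub] at e₂
      set S := coeff (0 + (i + 1) + k) (u.subst (X + X ^ (k + 1) * ψ)) -
        coeff (0 + (i + 1) + k) u
      rw [zero_add] at e₁
      set q := coeff (i + 1) u
      have e₃ : ‖((i + 1 : ℕ) : K) * q * constantCoeff ψ‖ ≤
          B * max (C₁ ^ (k + 1)) (D ^ (k + 1)) * factorialWeight K A i := by
        rw [show ((i + 1 : ℕ) : K) * q * constantCoeff ψ =
          S - (S - ((i + 1 : ℕ) : K) * constantCoeff ψ * q) by ring]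
        refine (norm_sub_le_max_norm _ _).trans (max_le (e₂.trans ?_) (e₁.trans ?_)) <;>
          refine mul_le_mul_of_nonneg_right (mul_le_mul_of_nonneg_left ?_ hB0) (hw0 i)
        · exact le_max_left _ _
        · exact le_max_right _ _
      have e₄ : ‖((i + 1 : ℕ) : K)‖ * ‖q‖ ≤ B * (M * factorialWeight K A i) := by
        rw [norm_mul, norm_mul, ← le_div_iff₀ hψ0] at e₃
        exact e₃.trans_eq (by simp only [M]; field_simp)
      have e₅ : B * (M * factorialWeight K A i) ≤
          ‖((i + 1 : ℕ) : K)‖ * (B * factorialWeight K A (i + 1)) := by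
        rw [mul_left_comm ‖_‖ B, norm_natCast_mul_factorialWeight]
        exact mul_le_mul_of_nonneg_left (mul_le_mul_of_nonneg_right hAM (hw0 i)) hB0
      exact le_of_mul_le_mul_left (e₄.trans e₅)
        (norm_pos_iff.mpr (by exact_mod_cast i.succ_ne_zero))
  refine hasGeometricGrowth_powerSeries_of_le (M := B) (C := A * E) (by positivity) fun n => ?_
  refine (key n).trans ?_
  rw [mul_pow, factorialWeight]
  gcongr
  exact hfac n

/-- Formal and analytic equivalence agree for the skew products `(f(x), lam(x) y)` with `f` tangent
to the identity. -/
theorem exists_analytic_skew_conj {f g lam mu h u : PowerSeries K}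
    (hf : HasGeometricGrowth (σ := Unit) f) (hg : HasGeometricGrowth (σ := Unit) g)
    (hlam : HasGeometricGrowth (σ := Unit) lam) (hmu : HasGeometricGrowth (σ := Unit) mu)
    (hf0 : constantCoeff f = 0) (hf1 : coeff 1 f = 1) (hlam0 : constantCoeff lam ≠ 0)
    (h0 : constantCoeff h = 0) (h1 : coeff 1 h ≠ 0) (hu0 : constantCoeff u ≠ 0)
    (hh : h.subst f = g.subst h) (hu : u.subst f * lam = mu.subst h * u) :
    ∃ h' u' : PowerSeries K, HasGeometricGrowth (σ := Unit) h' ∧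
      HasGeometricGrowth (σ := Unit) u' ∧ constantCoeff h' = 0 ∧ coeff 1 h' ≠ 0 ∧
      constantCoeff u' ≠ 0 ∧ h'.subst f = g.subst h' ∧ u'.subst f * lam = mu.subst h' * u' := by
  by_cases hfX : f = X
  · subst hfX
    have hs := HasSubst.of_constantCoeff_zero' h0
    have hgX : g = X := by
      refine sub_eq_zero.mp (eq_zero_of_subst_eq_zero h0 h1 ?_)
      rw [subst_sub hs, subst_X hs, ← hh, X_subst, sub_self]
    subst hgX
    have hune : u ≠ 0 := by rintro rfl; simp at hu0
    have hlm : lam = mu.subst h := by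
      rw [X_subst, mul_comm] at hu
      exact mul_right_cancel₀ hune hu
    have h1s : (1 : PowerSeries K).subst (X : PowerSeries K) = 1 := X_subst 1
    -- For constant `mu` the equations do not constrain `h`, which may diverge, so it is discarded
    -- in favour of x.
    by_cases hmuc : mu = C (constantCoeff mu)
    · refine ⟨X, 1, hasGeometricGrowth_X, hasGeometricGrowth_one, by simp, by simp, by simp, rfl,
        ?_⟩
      rw [h1s, one_mul, mul_one, X_subst, hlm, hmuc, subst_C]
      rfl
    · refine ⟨h, 1, hasGeometricGrowth_of_subst hmu hmuc h0 h1 (hlm ▸ hlam),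
        hasGeometricGrowth_one, h0, h1, by simp, hh, ?_⟩
      rw [h1s, one_mul, mul_one, hlm]
  · obtain ⟨n, ψ, hn, hψ⟩ := exists_eq_X_pow_mul (sub_ne_zero.mpr hfX)
    have hc : coeff n (f - X) ≠ 0 := by
      rw [hn, coeff_X_pow_mul', if_pos le_rfl, Nat.sub_self]; simpa using hψ
    obtain ⟨k, rfl⟩ : ∃ k, n = k + 1 + 1 := by
      rcases n with _ | _ | k
      · exact (hc (by simp [hf0])).elim
      · exact (hc (by simp [hf1])).elim
      · exact ⟨k, rfl⟩
    obtain rfl : f = X + X ^ (k + 1 + 1) * ψ := by rw [← hn]; ring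
    have hk : 1 ≤ k + 1 := by omega
    have hha := hasGeometricGrowth_of_conj_tangent hk hψ hf hg h0 h1 hh
    refine ⟨h, u, hha, ?_, h0, h1, hu0, hh, hu⟩
    have hmh : HasGeometricGrowth (σ := Unit) (mu.subst h) :=
      HasGeometricGrowth.powerSeries_subst (h := h) hha h0 hmu
    -- Dividing by the unit `lam` turns the second equation into u ∘ f = (1 + τ) u with 1 + τ = (mu
    -- ∘ h) / lam.
    refine hasGeometricGrowth_of_cocycle (τ := mu.subst h * lam⁻¹ - 1) hk hψ hf
      ((HasGeometricGrowth.mul hmh (hlam.powerSeries_inv hlam0)).sub hasGeometricGrowth_one) hu0 ?_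
    rw [add_sub_cancel, mul_right_comm, ← hu, mul_assoc, PowerSeries.mul_inv_cancel _ hlam0,
      mul_one]

end TangentGrowth

namespace FormalMap

open MvPowerSeries

/-! ### Skew products and restriction to the axis y = 0 -/

section Skew

variable {K : Type*} [Field K]

/-- The skew product `(f(x), lam(x) y)`. -/
noncomputable def skew (f lam : PowerSeries K) (hf : PowerSeries.constantCoeff f = 0) :
    FormalMap K 2 where
  comp := ![f.subst (X 0 : MvPowerSeries (Fin 2) K),
    lam.subst (X 0 : MvPowerSeries (Fin 2) K) * X 1]
  map_zero k := by
    fin_cases k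
    · exact PowerSeries.constantCoeff_subst_eq_zero (by simp) f hf
    · simp

theorem skew_comp_zero (f lam : PowerSeries K) (hf : PowerSeries.constantCoeff f = 0) :
    (skew f lam hf).comp 0 = f.subst (X 0 : MvPowerSeries (Fin 2) K) := rfl

theorem skew_comp_one (f lam : PowerSeries K) (hf : PowerSeries.constantCoeff f = 0) :
    (skew f lam hf).comp 1 = lam.subst (X 0 : MvPowerSeries (Fin 2) K) * X 1 := rfl

theorem coeff_powerSeries_subst_X_zero (f : PowerSeries K) (a : Fin 2 →₀ ℕ) :
    coeff a (f.subst (X 0 : MvPowerSeries (Fin 2) K)) =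
      if a 1 = 0 then PowerSeries.coeff (a 0) f else 0 := by
  rw [PowerSeries.coeff_subst_single]
  refine if_congr ⟨fun h => ?_, fun h => ?_⟩ rfl rfl
  · rw [h]; simp
  · ext i
    fin_cases i <;> simp [h]

theorem coeff_mul_X_one (f : MvPowerSeries (Fin 2) K) (a : Fin 2 →₀ ℕ) :
    coeff a (f * X 1) = if a 1 = 0 then 0 else coeff (a - Finsupp.single 1 1) f := by
  classical
  rw [X, coeff_mul_monomial, mul_one]
  simp only [Finsupp.single_le_iff, Nat.one_le_iff_ne_zero]
  split_ifs <;> first | rfl | contradiction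

theorem coeff_skew_zero (f lam : PowerSeries K) (hf : PowerSeries.constantCoeff f = 0)
    (a : Fin 2 →₀ ℕ) :
    coeff a ((skew f lam hf).comp 0) = if a 1 = 0 then PowerSeries.coeff (a 0) f else 0 :=
  coeff_powerSeries_subst_X_zero f a

theorem coeff_skew_one (f lam : PowerSeries K) (hf : PowerSeries.constantCoeff f = 0)
    (a : Fin 2 →₀ ℕ) :
    coeff a ((skew f lam hf).comp 1) = if a 1 = 1 then PowerSeries.coeff (a 0) lam else 0 := by
  rw [skew_comp_one, coeff_mul_X_one, coeff_powerSeries_subst_X_zero]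
  simp only [Finsupp.coe_tsub, Pi.sub_apply, Finsupp.single_eq_same]
  by_cases h0 : a 1 = 0
  · simp [h0]
  · by_cases h1 : a 1 = 1
    · simp [h1]
    · rw [if_neg h0, if_neg (by omega), if_neg h1]

theorem hasDiagonalLinearPart_skew (f lam : PowerSeries K) (hf : PowerSeries.constantCoeff f = 0) :
    (skew f lam hf).HasDiagonalLinearPart
      ![PowerSeries.coeff 1 f, PowerSeries.constantCoeff lam] := by
  intro i j
  fin_cases i
  · refine (coeff_skew_zero f lam hf _).trans ?_
    fin_cases j <;> simp
  · refine (coeff_skew_one f lam hf _).trans ?_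
    fin_cases j <;> simp

/-- A map containing only the monomials `x ^ n` and `x ^ n y` is a skew product. -/
theorem exists_eq_skew {N : FormalMap K 2}
    (h : ∀ (i : Fin 2) (a : Fin 2 →₀ ℕ), a 1 ≠ (i : ℕ) → coeff a (N.comp i) = 0) :
    ∃ (f lam : PowerSeries K) (hf : PowerSeries.constantCoeff f = 0), N = skew f lam hf ∧
      (∀ n, PowerSeries.coeff n f = coeff (Finsupp.single 0 n) (N.comp 0)) ∧
      ∀ n, PowerSeries.coeff n lam =
        coeff (Finsupp.single 0 n + Finsupp.single 1 1) (N.comp 1) := by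
  refine ⟨PowerSeries.mk fun n => coeff (Finsupp.single 0 n) (N.comp 0),
    PowerSeries.mk fun n => coeff (Finsupp.single 0 n + Finsupp.single 1 1) (N.comp 1), ?_, ?_,
    fun n => PowerSeries.coeff_mk _ _, fun n => PowerSeries.coeff_mk _ _⟩
  · rw [← PowerSeries.coeff_zero_eq_constantCoeff_apply, PowerSeries.coeff_mk, Finsupp.single_zero,
      coeff_zero_eq_constantCoeff_apply, N.map_zero]
  · ext i a
    fin_cases i
    · refine Eq.trans ?_ (coeff_skew_zero _ _ _ a).symm
      split_ifs with h1
      · rw [PowerSeries.coeff_mk]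
        congr 1
        congr 1
        ext j
        fin_cases j <;> simp [h1]
      · exact h 0 a (by simpa using h1)
    · refine Eq.trans ?_ (coeff_skew_one _ _ _ a).symm
      split_ifs with h1
      · rw [PowerSeries.coeff_mk]
        congr 1
        congr 1
        ext j
        fin_cases j <;> simp [h1]
      · exact h 1 a (by simpa using h1)

theorem powerSeries_subst_subst (a : PowerSeries K) {b : PowerSeries K}
    (hb : PowerSeries.constantCoeff b = 0) {σ : Type*} {c : MvPowerSeries σ K}
    (hc : constantCoeff c = 0) : a.subst (b.subst c) = PowerSeries.subst c (a.subst b) :=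
  (PowerSeries.subst_comp_subst_apply (PowerSeries.HasSubst.of_constantCoeff_zero' hb)
    (PowerSeries.HasSubst.of_constantCoeff_zero hc) a).symm

theorem subst_powerSeries_subst {r : ℕ} (H : FormalMap K r) (a : PowerSeries K)
    {b : MvPowerSeries (Fin r) K} (hb : constantCoeff b = 0) :
    subst H.comp (a.subst b) = a.subst (subst H.comp b) :=
  subst_comp_subst_apply (PowerSeries.HasSubst.of_constantCoeff_zero hb).const H.hasSubst a

theorem subst_comp_powerSeries_subst_X (H : FormalMap K 2) (a : PowerSeries K) :
    subst H.comp (a.subst (X 0 : MvPowerSeries (Fin 2) K)) = a.subst (H.comp 0) := by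
  rw [subst_powerSeries_subst H a (by simp), subst_X H.hasSubst]

/-- Skew products satisfying the one-variable conjugation equations are conjugate. -/
theorem skew_mul_skew {f g lam mu h u : PowerSeries K} (hf : PowerSeries.constantCoeff f = 0)
    (hg : PowerSeries.constantCoeff g = 0) (hh : PowerSeries.constantCoeff h = 0)
    (h1 : h.subst f = g.subst h) (h2 : u.subst f * lam = mu.subst h * u) :
    skew h u hh * skew f lam hf = skew g mu hg * skew h u hh := by
  have hX : constantCoeff (X 0 : MvPowerSeries (Fin 2) K) = 0 := by simp
  have hXs : PowerSeries.HasSubst (X 0 : MvPowerSeries (Fin 2) K) := .X 0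
  have key : ∀ i, (skew h u hh * skew f lam hf).comp i = (skew g mu hg * skew h u hh).comp i := by
    intro i
    rw [mul_comp, mul_comp]
    fin_cases i
    · change subst _ ((skew h u hh).comp 0) = subst _ ((skew g mu hg).comp 0)
      rw [skew_comp_zero h, skew_comp_zero g, subst_comp_powerSeries_subst_X,
        subst_comp_powerSeries_subst_X, skew_comp_zero, skew_comp_zero,
        powerSeries_subst_subst _ hf hX, powerSeries_subst_subst _ hh hX, h1]
    · change subst _ ((skew h u hh).comp 1) = subst _ ((skew g mu hg).comp 1)
      rw [skew_comp_one h, skew_comp_one g, subst_mul (hasSubst _), subst_mul (hasSubst _),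
        subst_comp_powerSeries_subst_X, subst_comp_powerSeries_subst_X, subst_X (hasSubst _),
        subst_X (hasSubst _), skew_comp_zero, skew_comp_zero, skew_comp_one, skew_comp_one,
        powerSeries_subst_subst _ hf hX, powerSeries_subst_subst _ hh hX, ← mul_assoc, ← mul_assoc,
        ← PowerSeries.subst_mul hXs, ← PowerSeries.subst_mul hXs, h2]
  ext1
  exact funext key

/-- The family `(x, 0)` used to restrict a series to the axis `y = 0`. -/
noncomputable def axisFamily (K : Type*) [Field K] : Fin 2 → MvPowerSeries Unit K :=
  ![(PowerSeries.X : PowerSeries K), 0]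

theorem hasSubst_axisFamily : HasSubst (axisFamily K) := by
  refine hasSubst_of_constantCoeff_zero fun i => ?_
  fin_cases i
  · exact PowerSeries.constantCoeff_X
  · exact _root_.map_zero _

/-- The restriction of a series to the axis `y = 0`. -/
noncomputable def restrictAxis (f : MvPowerSeries (Fin 2) K) : PowerSeries K :=
  subst (axisFamily K) f

theorem restrictAxis_mul (f g : MvPowerSeries (Fin 2) K) :
    restrictAxis (f * g) = restrictAxis f * restrictAxis g := subst_mul hasSubst_axisFamily f g

theorem restrictAxis_X_zero : restrictAxis (X 0 : MvPowerSeries (Fin 2) K) = PowerSeries.X :=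
  subst_X hasSubst_axisFamily 0

theorem restrictAxis_X_one : restrictAxis (X 1 : MvPowerSeries (Fin 2) K) = 0 :=
  subst_X hasSubst_axisFamily 1

theorem coeff_restrictAxis (f : MvPowerSeries (Fin 2) K) (n : ℕ) :
    PowerSeries.coeff n (restrictAxis f) = coeff (Finsupp.single 0 n) f := by
  classical
  have hprod : ∀ b : Fin 2 →₀ ℕ, (b.prod fun s e => axisFamily K s ^ e) =
      (PowerSeries.X : PowerSeries K) ^ b 0 * 0 ^ b 1 := by
    intro b
    rw [Finsupp.prod_fintype _ _ (fun _ => pow_zero _), Fin.prod_univ_two]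
    rfl
  rw [restrictAxis, PowerSeries.coeff, coeff_subst hasSubst_axisFamily,
    finsum_eq_single _ (Finsupp.single 0 n)]
  · rw [hprod]
    have := PowerSeries.coeff_X_pow_self (R := K) n
    rw [PowerSeries.coeff] at this
    simp [this]
  · intro b hb
    rw [hprod]
    by_cases h1 : b 1 = 0
    · have h0 : n ≠ b 0 := by
        rintro rfl
        refine hb ?_
        ext i
        fin_cases i <;> simp [h1]
      have := PowerSeries.coeff_X_pow (R := K) n (b 0)
      rw [PowerSeries.coeff, if_neg h0] at this
      rw [h1, pow_zero, mul_one, this, smul_zero]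
    · rw [zero_pow h1, mul_zero, _root_.map_zero, smul_zero]

theorem constantCoeff_restrictAxis (f : MvPowerSeries (Fin 2) K) :
    PowerSeries.constantCoeff (restrictAxis f) = constantCoeff f := by
  rw [← PowerSeries.coeff_zero_eq_constantCoeff_apply, coeff_restrictAxis, Finsupp.single_zero,
    coeff_zero_eq_constantCoeff_apply]

theorem restrictAxis_powerSeries_subst (a : PowerSeries K) {b : MvPowerSeries (Fin 2) K}
    (hb : constantCoeff b = 0) : restrictAxis (a.subst b) = a.subst (restrictAxis b) :=
  subst_comp_subst_apply (PowerSeries.HasSubst.of_constantCoeff_zero hb).const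
    hasSubst_axisFamily a

/-- Composition with a map preserving the axis restricts to one-variable composition. -/
theorem restrictAxis_subst {N : FormalMap K 2} (h1 : restrictAxis (N.comp 1) = 0)
    (a : MvPowerSeries (Fin 2) K) :
    restrictAxis (subst N.comp a) = (restrictAxis a).subst (restrictAxis (N.comp 0)) := by
  have h0 : PowerSeries.constantCoeff (restrictAxis (N.comp 0)) = 0 := by
    rw [constantCoeff_restrictAxis, N.map_zero]
  have hs := PowerSeries.HasSubst.of_constantCoeff_zero' h0
  have e1 : restrictAxis (subst N.comp a) = subst (fun s => subst (axisFamily K) (N.comp s)) a :=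
    subst_comp_subst_apply N.hasSubst hasSubst_axisFamily a
  have e2 : (restrictAxis a).subst (restrictAxis (N.comp 0)) =
      subst (fun s => subst (fun _ : Unit => restrictAxis (N.comp 0)) (axisFamily K s)) a :=
    subst_comp_subst_apply hasSubst_axisFamily hs.const a
  rw [e1, e2]
  congr 1
  funext s
  fin_cases s
  · exact (PowerSeries.subst_X hs).symm
  · refine h1.trans ?_
    have : subst (fun _ : Unit => restrictAxis (N.comp 0)) (0 : MvPowerSeries Unit K) = 0 := by
      rw [← coe_substAlgHom hs.const, _root_.map_zero]
    exact this.symm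

/-- A formal conjugation of skew products yields a solution of the one-variable conjugation
equations. -/
theorem exists_skew_conj {f g lam mu : PowerSeries K} (hf : PowerSeries.constantCoeff f = 0)
    (hg : PowerSeries.constantCoeff g = 0) (hf1 : PowerSeries.coeff 1 f = 1)
    (hmu : PowerSeries.constantCoeff mu ≠ 1) {H H' : FormalMap K 2} (hH : H * H' = 1)
    (hH' : H' * H = 1) (hconj : H * skew f lam hf = skew g mu hg * H) :
    ∃ h u : PowerSeries K, PowerSeries.constantCoeff h = 0 ∧ PowerSeries.coeff 1 h ≠ 0 ∧
      PowerSeries.constantCoeff u ≠ 0 ∧ h.subst f = g.subst h ∧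
      u.subst f * lam = mu.subst h * u := by
  have hX : constantCoeff (X 0 : MvPowerSeries (Fin 2) K) = 0 := by simp
  have hN0 : restrictAxis ((skew f lam hf).comp 0) = f := by
    rw [skew_comp_zero, restrictAxis_powerSeries_subst _ hX, restrictAxis_X_zero,
      PowerSeries.X_subst]
  have hN1 : restrictAxis ((skew f lam hf).comp 1) = 0 := by
    rw [skew_comp_one, restrictAxis_mul, restrictAxis_X_one, mul_zero]
  have hres : ∀ a : MvPowerSeries (Fin 2) K,
      restrictAxis (subst (skew f lam hf).comp a) = (restrictAxis a).subst f := by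
    intro a
    rw [restrictAxis_subst hN1, hN0]
  have hrX : ∀ a : PowerSeries K, restrictAxis (a.subst (X 0 : MvPowerSeries (Fin 2) K)) = a := by
    intro a
    rw [restrictAxis_powerSeries_subst _ hX, restrictAxis_X_zero, PowerSeries.X_subst]
  have c0 : subst (skew f lam hf).comp (H.comp 0) = g.subst (H.comp 0) := by
    have := congrArg (fun F : FormalMap K 2 => F.comp 0) hconj
    simp only [mul_comp] at this
    rw [this, skew_comp_zero, subst_comp_powerSeries_subst_X]
  have c1 : subst (skew f lam hf).comp (H.comp 1) = mu.subst (H.comp 0) * H.comp 1 := by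
    have := congrArg (fun F : FormalMap K 2 => F.comp 1) hconj
    simp only [mul_comp] at this
    rw [this, skew_comp_one, subst_mul H.hasSubst, subst_comp_powerSeries_subst_X,
      subst_X H.hasSubst]
  have hh0 : PowerSeries.constantCoeff (restrictAxis (H.comp 0)) = 0 := by
    rw [constantCoeff_restrictAxis, H.map_zero]
  -- The restriction v satisfies v ∘ f = (mu ∘ h) v. As f is tangent to the identity, comparing
  -- leading coefficients of a nonzero v would give mu(0) = 1. Thus `H` preserves the axis.
  have hv : restrictAxis (H.comp 1) = 0 := by
    have hveq := congrArg restrictAxis c1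
    rw [hres, restrictAxis_mul, restrictAxis_powerSeries_subst _ (H.map_zero 0)] at hveq
    by_contra hv0
    obtain ⟨n, ψ, hn, hψ⟩ := exists_eq_X_pow_mul hv0
    have hlow : ∀ r < n, PowerSeries.coeff r (restrictAxis (H.comp 1)) = 0 := fun r hr => by
      rw [hn, PowerSeries.coeff_X_pow_mul', if_neg (by omega)]
    have hlead : PowerSeries.coeff n (restrictAxis (H.comp 1)) = PowerSeries.constantCoeff ψ := by
      rw [hn, PowerSeries.coeff_X_pow_mul', if_pos le_rfl, Nat.sub_self,
        PowerSeries.coeff_zero_eq_constantCoeff_apply]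
    have h2 := congrArg (PowerSeries.coeff n) hveq
    rw [coeff_subst_of_lt hf hlow, hf1, one_pow, mul_one, hlead, hn, mul_left_comm,
      PowerSeries.coeff_X_pow_mul', if_pos le_rfl, Nat.sub_self,
      PowerSeries.coeff_zero_eq_constantCoeff_apply, map_mul] at h2
    have h3 : PowerSeries.constantCoeff (mu.subst (restrictAxis (H.comp 0))) =
        PowerSeries.constantCoeff mu := by
      have := coeff_subst_of_lt (n := 0) (g := mu) hh0 (by simp)
      simpa using this
    rw [h3] at h2
    exact hmu (mul_right_cancel₀ hψ (by rw [one_mul]; exact h2.symm))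
  obtain ⟨U, hU⟩ : (X 1 : MvPowerSeries (Fin 2) K) ∣ H.comp 1 := by
    rw [X_dvd_iff]
    intro m hm
    have : m = Finsupp.single 0 (m 0) := by
      ext i
      fin_cases i <;> simp [hm]
    rw [this, ← coeff_restrictAxis, hv, _root_.map_zero]
  refine ⟨restrictAxis (H.comp 0), restrictAxis U, hh0, ?_, ?_, ?_, ?_⟩
  · intro h1
    have h2 := congrArg (fun F : FormalMap K 2 => restrictAxis (F.comp 0)) hH'
    simp only [mul_comp, one_comp] at h2
    rw [restrictAxis_subst hv, restrictAxis_X_zero] at h2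
    have h3 := congrArg (PowerSeries.coeff 1) h2
    rw [coeff_subst_of_lt hh0, h1, zero_pow one_ne_zero, mul_zero, PowerSeries.coeff_one_X] at h3
    · exact zero_ne_one h3
    · intro r hr
      obtain rfl : r = 0 := by omega
      rw [PowerSeries.coeff_zero_eq_constantCoeff_apply, constantCoeff_restrictAxis, H'.map_zero]
  · intro hu0
    rw [constantCoeff_restrictAxis] at hu0
    -- If U(0) = 0, then y = H'₁ · (U ∘ H') would have order at least two.
    have h2 := congrArg (fun F : FormalMap K 2 => F.comp 1) hH
    simp only [mul_comp, one_comp] at h2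
    rw [hU, subst_mul H'.hasSubst, subst_X H'.hasSubst] at h2
    have h3 := (VanishBelow.of_constantCoeff (H'.map_zero 1)).mul (VanishBelow.of_constantCoeff
      (constantCoeff_subst_eq_zero H'.hasSubst H'.map_zero hu0)) (Finsupp.single 1 1) (by simp)
    rw [h2, coeff_index_single_self_X] at h3
    exact one_ne_zero h3
  · have := congrArg restrictAxis c0
    rwa [hres, restrictAxis_powerSeries_subst _ (H.map_zero 0)] at this
  · have h2 : lam.subst (X 0 : MvPowerSeries (Fin 2) K) * subst (skew f lam hf).comp U =
        mu.subst (H.comp 0) * U := by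
      have hX1 : (X 1 : MvPowerSeries (Fin 2) K) ≠ 0 := by
        intro h0
        have := coeff_index_single_self_X (R := K) (1 : Fin 2)
        rw [h0, _root_.map_zero] at this
        exact zero_ne_one this
      refine mul_left_cancel₀ hX1 ?_
      rw [hU, subst_mul (hasSubst _), subst_X (hasSubst _), skew_comp_one] at c1
      calc _ = lam.subst (X 0 : MvPowerSeries (Fin 2) K) * X 1 * subst (skew f lam hf).comp U := by
            ring
        _ = _ := by rw [c1]; ring
    have h3 := congrArg restrictAxis h2
    rw [restrictAxis_mul, hres, restrictAxis_mul, hrX,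
      restrictAxis_powerSeries_subst _ (H.map_zero 0)] at h3
    rw [mul_comm, h3]

end Skew

/-! ### Semihyperbolic maps -/

section SemiHyperbolic

variable {K : Type*} [NontriviallyNormedField K] [IsUltrametricDist K] [CompleteSpace K]

theorem isAnalytic_skew {f lam : PowerSeries K} (hf : PowerSeries.constantCoeff f = 0)
    (hfg : HasGeometricGrowth (σ := Unit) f) (hlg : HasGeometricGrowth (σ := Unit) lam) :
    (skew f lam hf).IsAnalytic := by
  classical
  have hX : ∀ i, HasGeometricGrowth (X i : MvPowerSeries (Fin 2) K) := fun i =>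
    .of_le (M := 1) zero_le_one fun a => by rw [coeff_X]; split_ifs <;> simp
  rw [isAnalytic_iff]
  intro i
  fin_cases i
  · exact (hX 0).powerSeries_subst (by simp) hfg
  · exact ((hX 0).powerSeries_subst (by simp) hlg).mul (hX 1)

/-- The given conjugation need be neither analytic nor a skew product. Only its data h, u along the
axis are kept; they are made analytic and reassembled into a skew conjugation. -/
theorem FormallyEquivalent.analyticallyEquivalent_skew [CharZero K] {f g lam mu : PowerSeries K}
    (hf : PowerSeries.constantCoeff f = 0) (hg : PowerSeries.constantCoeff g = 0)
    (hfg : HasGeometricGrowth (σ := Unit) f) (hgg : HasGeometricGrowth (σ := Unit) g)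
    (hlam : HasGeometricGrowth (σ := Unit) lam) (hmu : HasGeometricGrowth (σ := Unit) mu)
    (hf1 : PowerSeries.coeff 1 f = 1) (hlam0 : PowerSeries.constantCoeff lam ≠ 0)
    (hmu1 : PowerSeries.constantCoeff mu ≠ 1)
    (h : (skew f lam hf).FormallyEquivalent (skew g mu hg)) :
    (skew f lam hf).AnalyticallyEquivalent (skew g mu hg) := by
  obtain ⟨H, H', ⟨h1, h2⟩, h3⟩ := h
  have hconj : H * skew f lam hf = skew g mu hg * H := by
    rw [← h3]
    change H * skew f lam hf = H * skew f lam hf * H' * H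
    rw [mul_assoc (H * _), show H' * H = 1 from h2, mul_one]
  obtain ⟨h, u, hh0, hh1, hu0, e1, e2⟩ := exists_skew_conj hf hg hf1 hmu1 h1 h2 hconj
  obtain ⟨h', u', hha, hua, hh0', hh1', hu0', e1', e2'⟩ :=
    exists_analytic_skew_conj hfg hgg hlam hmu hf hf1 hlam0 hh0 hh1 hu0 e1 e2
  refine .of_mul_eq_mul (fun i => ?_) (hasDiagonalLinearPart_skew h' u' hh0')
    (isAnalytic_skew hh0' hha hua) (skew_mul_skew hf hg hh0' e1' e2')
  fin_cases i
  · exact hh1'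
  · exact hu0'

/-- A semihyperbolic analytic map is analytically conjugate to a skew product. -/
theorem exists_analyticallyEquivalent_skew {F : FormalMap K 2} {c : K} (hc0 : c ≠ 0)
    (hc : ‖c‖ < 1) (hF : F.HasDiagonalLinearPart ![1, c]) (hFa : F.IsAnalytic) :
    ∃ (f lam : PowerSeries K) (hf : PowerSeries.constantCoeff f = 0),
      HasGeometricGrowth (σ := Unit) f ∧ HasGeometricGrowth (σ := Unit) lam ∧
      PowerSeries.coeff 1 f = 1 ∧ PowerSeries.constantCoeff lam = c ∧
      F.AnalyticallyEquivalent (skew f lam hf) := by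
  have hev : ∀ a : Fin 2 →₀ ℕ, eigenvalue ![1, c] a = c ^ a 1 := fun a => by
    simp [eigenvalue, Fin.prod_univ_two]
  have hnorm : ∀ x : K, ‖x‖ < 1 → ‖x - 1‖ = 1 := by
    intro x hx
    rw [sub_eq_add_neg, IsUltrametricDist.norm_add_eq_max_of_norm_ne_norm, norm_neg, norm_one,
      max_eq_right hx.le]
    rw [norm_neg, norm_one]; exact hx.ne
  have hpow : ∀ n : ℕ, n ≠ 0 → ‖c ^ n - 1‖ = 1 := fun n hn =>
    hnorm _ (by rw [norm_pow]; exact pow_lt_one₀ (norm_nonneg _) hc hn)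
  -- The resonant monomials are x^m in the first component and x^m y in the second. The other
  -- divisors are c^n - 1 of norm 1, and 1 - c of norm 1 or c (c^n - 1) of norm |c|; hence δ = |c|.
  obtain ⟨H, N, hH, hN, hHa, hNa, hconj, hNR⟩ := exists_normalForm hF
    (by intro i; fin_cases i <;> simp [hc.le]) hFa (fun i a => a 1 = (i : ℕ))
    (norm_pos_iff.mpr hc0) hc.le (by
      intro i a ha
      rw [hev]
      fin_cases i
      · change ¬ a 1 = 0 at ha
        change ‖c‖ ≤ ‖c ^ a 1 - 1‖
        rw [hpow _ ha]; exact hc.le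
      · change ¬ a 1 = 1 at ha
        change ‖c‖ ≤ ‖c ^ a 1 - c‖
        rcases Nat.eq_zero_or_pos (a 1) with h0 | h0
        · rw [h0, pow_zero, norm_sub_rev, hnorm c hc]; exact hc.le
        · obtain ⟨n, hn⟩ : ∃ n, a 1 = n + 1 := ⟨a 1 - 1, by omega⟩
          rw [hn, show c ^ (n + 1) - c = (c ^ n - 1) * c by ring, norm_mul, hpow n (by omega),
            one_mul])
  have hNR' : ∀ (i : Fin 2) (a : Fin 2 →₀ ℕ), a 1 ≠ (i : ℕ) → coeff a (N.comp i) = 0 := by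
    intro i a ha
    rcases Nat.lt_or_ge a.degree 2 with h2 | h2
    · rcases Nat.eq_zero_or_pos a.degree with h0 | h0
      · exact N.coeff_eq_zero_of_degree_eq_zero i h0
      · obtain ⟨j, rfl⟩ := exists_eq_single_of_degree_eq_one (show a.degree = 1 by omega)
        rw [hN i j, if_neg]
        rintro rfl
        refine ha ?_
        fin_cases i <;> simp
    · exact hNR i a h2 ha
  obtain ⟨f, lam, hf, rfl, hfc, hlc⟩ := exists_eq_skew hNR'
  rw [isAnalytic_iff] at hNa
  refine ⟨f, lam, hf, ?_, ?_, ?_, ?_, ?_⟩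
  · obtain ⟨C, hC, h⟩ := hNa 0
    exact hasGeometricGrowth_powerSeries_iff.mpr ⟨C, hC, fun n => by
      rw [hfc]; simpa using h (Finsupp.single 0 n)⟩
  · obtain ⟨C, hC, h⟩ := hNa 1
    refine hasGeometricGrowth_powerSeries_of_le (M := C ^ 2) (C := C) (by positivity) fun n => ?_
    rw [hlc]
    refine (h _).trans_eq ?_
    rw [map_add, Finsupp.degree_single, Finsupp.degree_single]
    ring
  · rw [hfc, hN 0 0]; rfl
  · rw [← PowerSeries.coeff_zero_eq_constantCoeff_apply, hlc, Finsupp.single_zero, zero_add,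
      hN 1 1]
    rfl
  · exact .of_mul_eq_mul (fun i => one_ne_zero) hH hHa hconj

theorem FormallyEquivalent.analyticallyEquivalent_of_semihyperbolic [CharZero K]
    {F G : FormalMap K 2} {c : K} (hc0 : c ≠ 0) (hc : ‖c‖ < 1)
    (hF : F.HasDiagonalLinearPart ![1, c]) (hG : G.HasDiagonalLinearPart ![1, c])
    (hFa : F.IsAnalytic) (hGa : G.IsAnalytic) (h : F.FormallyEquivalent G) :
    F.AnalyticallyEquivalent G := by
  obtain ⟨f, lam, hf, hfg, hlam, hf1, hlam0, hFN⟩ :=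
    exists_analyticallyEquivalent_skew hc0 hc hF hFa
  obtain ⟨g, mu, hg, hgg, hmu, hg1, hmu0, hGN⟩ :=
    exists_analyticallyEquivalent_skew hc0 hc hG hGa
  have hc1 : c ≠ 1 := by rintro rfl; simp at hc
  have hform := (hFN.formallyEquivalent.symm.trans h).trans hGN.formallyEquivalent
  exact (hFN.trans (hform.analyticallyEquivalent_skew hf hg hfg hgg hlam hmu hf1 (hlam0 ▸ hc0)
    (hmu0 ▸ hc1))).trans hGN.symm

end SemiHyperbolic

end FormalMap

/-! ### Reduction of the theorem to the contracting situation -/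

theorem theorem1p1 {K : Type*} [NontriviallyNormedField K] [IsUltrametricDist K]
    [CompleteSpace K] [CharZero K] (l₁ l₂ : K) (hl₁ : l₁ ≠ 0) (hl₂ : l₂ ≠ 0)
    (F G : FormalMap K 2) (hF : F.IsAnalytic) (hG : G.IsAnalytic)
    (hFl : F.HasDiagonalLinearPart ![l₁, l₂]) (hGl : G.HasDiagonalLinearPart ![l₁, l₂])
    (h : ((∃ n : ℕ, 2 ≤ n ∧ l₂ = l₁ ^ n) ∧ ‖l₁‖ ≠ 1 ∧ ‖l₂‖ ≠ 1) ∨ (l₁ = 1 ∧ ‖l₂‖ ≠ 1)) :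
    F.FormallyEquivalent G ↔ F.AnalyticallyEquivalent G := by
  refine ⟨fun hfe => ?_, FormalMap.AnalyticallyEquivalent.formallyEquivalent⟩
  have hl0 : ∀ i, ![l₁, l₂] i ≠ 0 := by
    intro i
    fin_cases i
    · exact hl₁
    · exact hl₂
  have hinvl : (![l₁, l₂] : Fin 2 → K)⁻¹ = ![l₁⁻¹, l₂⁻¹] := by
    funext i
    fin_cases i <;> rfl
  rcases h with ⟨⟨n, hn, hl⟩, h1, h2⟩ | ⟨rfl, h2⟩
  -- Equality would give l₁^(n-1) = 1 with n - 1 ≥ 1, contradicting |l₁| ≠ 1.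
  · have hne : l₁ ≠ l₂ := by
      intro he
      have h3 : ‖l₁‖ ^ (n - 1) = 1 := by
        have h4 : l₁ ^ (n - 1) * l₁ = 1 * l₁ := by
          rw [← pow_succ, Nat.sub_add_cancel (by omega), one_mul, ← hl, ← he]
        rw [← norm_pow, mul_right_cancel₀ hl₁ h4, norm_one]
      exact h1 ((pow_eq_one_iff_of_nonneg (norm_nonneg _) (by omega)).mp h3)
    have hinj : ∀ a b : K, a ≠ b → Function.Injective ![a, b] := by
      intro a b hab i j hij
      fin_cases i <;> fin_cases j <;> simp_all [eq_comm]
    have hlt : ∀ a b : K, ‖a‖ < 1 → ‖b‖ < 1 → ∀ i, ‖![a, b] i‖ < 1 := by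
      intro a b ha hb i
      fin_cases i
      · exact ha
      · exact hb
    rcases lt_or_gt_of_ne h1 with h3 | h3
    · have h4 : ‖l₂‖ < 1 := by
        rw [hl, norm_pow]; exact pow_lt_one₀ (norm_nonneg _) h3 (by omega)
      exact hfe.analyticallyEquivalent_of_attracting hl0 (hlt _ _ h3 h4) (hinj _ _ hne) hFl hGl
        hF hG
    · have h4 : 1 < ‖l₂‖ := by
        rw [hl, norm_pow]; exact one_lt_pow₀ h3 (by omega)
      -- In the repelling case the inverse maps are attracting.
      refine hfe.analyticallyEquivalent_of_inverse hl0 hFl hGl hF hG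
        fun F' G' hF' hG' hFa hGa hfe' => ?_
      rw [hinvl] at hF' hG'
      refine hfe'.analyticallyEquivalent_of_attracting ?_
        (hlt _ _ (by rw [norm_inv]; exact inv_lt_one_of_one_lt₀ h3)
          (by rw [norm_inv]; exact inv_lt_one_of_one_lt₀ h4))
        (hinj _ _ (inv_injective.ne hne)) hF' hG' hFa hGa
      rw [← hinvl]
      exact fun i => inv_ne_zero (hl0 i)
  · rcases lt_or_gt_of_ne h2 with h3 | h3
    · exact hfe.analyticallyEquivalent_of_semihyperbolic hl₂ h3 hFl hGl hF hG
    · refine hfe.analyticallyEquivalent_of_inverse hl0 hFl hGl hF hG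
        fun F' G' hF' hG' hFa hGa hfe' => ?_
      rw [hinvl, inv_one] at hF' hG'
      exact hfe'.analyticallyEquivalent_of_semihyperbolic (inv_ne_zero hl₂)
        (by rw [norm_inv]; exact inv_lt_one_of_one_lt₀ h3) hF' hG' hFa hGa
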